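/- Let $\alpha\ge -\tfrac12$ and let $P_n^{(\alpha)}$ ($n\ge 0$) be the Gegenbauer polynomials normalized by $P_n^{(\alpha)}(1)=1$, i.e. $P_0^{(\alpha)}=1$, $P_1^{(\alpha)}(t)=t$ and $$t\,P_n^{(\alpha)}(t)=\frac{n}{2n+2\alpha+1}P_{n-1}^{(\alpha)}(t)+\frac{n+2\alpha+1}{2n+2\alpha+1}P_{n+1}^{(\alpha)}(t)\qquad(n\ge 1).$$ Write $P_m^{(\alpha)}P_n^{(\alpha)}=\sum_k c(m,n,k)P_k^{(\alpha)}$, put $\delta_m\star\delta_n=\sum_k c(m,n,k)\,\delta_k$ and extend $\star$ bilinearly to probability measures on $\mathbb N=\{0,1,2,\dots\}$. Let $\mu$ be a probability measure on $\mathbb N$ with $\sum_n n^2\mu(n)<\infty$, and let $p^{(n)}(x,y)$ be the $n$-step transition probabilities of the Markov chain on $\mathbb N$ with kernel $p(x,y)=(\delta_x\star\mu)(y)$. Assume that $\mu$ is aperiodic, i.e. the support of $\mu$ is contained neither in $2\mathbb N$ nor in $2\mathbb N+1$ and, if $\alpha=-\tfrac12$, it is not contained in $d\,\mathbb N$ for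 any integer $d\ge 2$. Let $$C=\frac{1}{4(\alpha+1)}\sum_{n\ge1}\mu(n)\,n(n+2\alpha+1).$$ Then, for every real $x>0$, as $n\to\infty$, $$\sqrt n\;p^{(n)}\big(\lfloor x\sqrt n\rfloor,\lfloor x\sqrt n\rfloor\big)\sim\frac{x}{2C}\,e^{-x^2/(2C)}\,I_\alpha\!\Big(\frac{x^2}{2C}\Big)$$ and $$\sqrt n\;p^{(n)}\big(0,\lfloor x\sqrt n\rfloor\big)\sim\frac{x^{2\alpha+1}e^{-x^2/(4C)}}{2^{2\alpha+1}C^{\alpha+1}\Gamma(\alpha+1)},$$ where $I_\alpha(z)=\sum_{k\ge0}\frac{(z/2)^{2k+\alpha}}{k!\,\Gamma(k+\alpha+1)}$ is the modified Bessel function of the first kind. -/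

import Mathlib

open Filter Asymptotics Polynomial

noncomputable section

namespace GegenbauerWalk

/-- The Gegenbauer (ultraspherical) polynomial `P_n^{(α)}`, normalized by `P_n^{(α)}(1) = 1`:
`P_0 = 1`, `P_1 = X` and, for `n ≥ 1`,
`X P_n = n / (2n + 2α + 1) P_{n-1} + (n + 2α + 1) / (2n + 2α + 1) P_{n+1}`.
The Rodrigues formula is proved below in `gegenbauer_rodrigues`. -/
def gegenbauer (α : ℝ) : ℕ → ℝ[X]
  | 0 => 1
  | 1 => X
  | n + 2 => C (((n : ℝ) + 2 * α + 2)⁻¹) *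
      (C (2 * (n : ℝ) + 2 * α + 3) * X * gegenbauer α (n + 1)
        - C ((n : ℝ) + 1) * gegenbauer α n)

theorem gegenbauer_eval_succ_succ (α x : ℝ) (n : ℕ) :
    (gegenbauer α (n + 2)).eval x = ((n : ℝ) + 2 * α + 2)⁻¹ *
      ((2 * (n : ℝ) + 2 * α + 3) * x * (gegenbauer α (n + 1)).eval x
        - ((n : ℝ) + 1) * (gegenbauer α n).eval x) := by
  simp [gegenbauer]

theorem gegenbauer_eval_deriv_succ_succ (α x : ℝ) (n : ℕ) :
    (derivative (gegenbauer α (n + 2))).eval x = ((n : ℝ) + 2 * α + 2)⁻¹ *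
      ((2 * (n : ℝ) + 2 * α + 3) * ((gegenbauer α (n + 1)).eval x
          + x * (derivative (gegenbauer α (n + 1))).eval x)
        - ((n : ℝ) + 1) * (derivative (gegenbauer α n)).eval x) := by
  simp only [gegenbauer, derivative_mul, derivative_sub, derivative_C, derivative_X, eval_add,
    eval_mul, eval_sub, eval_C, eval_X, zero_mul, zero_add, mul_one]
  ring

theorem gegenbauer_shift_aux (α : ℝ) (hα : -1 < α) (x : ℝ) (n : ℕ) :
    2 * (α + 1) * (x * (gegenbauer α (n + 1)).eval x - (gegenbauer α n).eval x)
      = -((n : ℝ) + 2 * α + 2) * (1 - x ^ 2) * (gegenbauer (α + 1) n).eval x := by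
  induction n using Nat.twoStepInduction with
  | zero => simp [gegenbauer]; ring
  | one =>
    have h : α + 1 ≠ 0 := by linarith
    have e : (2 * α + 2) * (gegenbauer α 2).eval x = (2 * α + 3) * x * x - 1 := by
      rw [gegenbauer_eval_succ_succ]
      simp [gegenbauer]
      field_simp
    have q : (gegenbauer (α + 1) 1).eval x = x := by simp [gegenbauer]
    have p : (gegenbauer α 1).eval x = x := by simp [gegenbauer]
    rw [q, p]
    push_cast
    linear_combination x * e
  | more n h0 h1 =>
    have hn : (0 : ℝ) ≤ n := n.cast_nonneg
    have a2 : ((n : ℝ) + 2 * α + 2) ≠ 0 := by linarith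
    have a3 : ((n : ℝ) + 2 * α + 3) ≠ 0 := by linarith
    have a3' : (((n + 1 : ℕ) : ℝ) + 2 * α + 2) ≠ 0 := by push_cast; linarith
    have a4' : ((n : ℝ) + 2 * (α + 1) + 2) ≠ 0 := by linarith
    have e2 := gegenbauer_eval_succ_succ α x n
    have e3 := gegenbauer_eval_succ_succ α x (n + 1)
    have q2 := gegenbauer_eval_succ_succ (α + 1) x n
    rw [eq_inv_mul_iff_mul_eq₀ (by assumption)] at e2 e3 q2
    push_cast at e3 h1 ⊢
    refine mul_left_cancel₀ (mul_ne_zero a2 a3) ?_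
    linear_combination (-(1 - x ^ 2) * (n + 2 * α + 2) * (n + 2 * α + 3)) * -q2
      + ((n + 2 * α + 2) * (2 * n + 2 * α + 5) * x) * h1 - ((n + 2 * α + 3) * (n + 1)) * h0
      + (2 * (α + 1) * (n + 2 * α + 2) * x) * e3 - (2 * (α + 1) * (n + 2 * α + 3)) * e2

theorem gegenbauer_shift_deriv_aux (α : ℝ) (hα : -1 < α) (x : ℝ) (n : ℕ) :
    2 * (α + 1) * (gegenbauer α (n + 1)).eval x
      = 2 * (α + 1) * x * (gegenbauer (α + 1) n).eval x
        - (1 - x ^ 2) * (derivative (gegenbauer (α + 1) n)).eval x := by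
  induction n using Nat.twoStepInduction with
  | zero => simp [gegenbauer]
  | one =>
    have h : α + 1 ≠ 0 := by linarith
    have e : (2 * α + 2) * (gegenbauer α 2).eval x = (2 * α + 3) * x * x - 1 := by
      rw [gegenbauer_eval_succ_succ]
      simp [gegenbauer]
      field_simp
    have q : (gegenbauer (α + 1) 1).eval x = x := by simp [gegenbauer]
    have d : (derivative (gegenbauer (α + 1) 1)).eval x = 1 := by simp [gegenbauer]
    rw [q, d]
    linear_combination e
  | more n h0 h1 =>
    have hn : (0 : ℝ) ≤ n := n.cast_nonneg
    have a3 : ((n : ℝ) + 2 * α + 3) ≠ 0 := by linarith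
    have a3' : (((n + 1 : ℕ) : ℝ) + 2 * α + 2) ≠ 0 := by push_cast; linarith
    have a4 : ((n : ℝ) + 2 * α + 4) ≠ 0 := by linarith
    have a4' : ((n : ℝ) + 2 * (α + 1) + 2) ≠ 0 := by linarith
    have e3 := gegenbauer_eval_succ_succ α x (n + 1)
    have q2 := gegenbauer_eval_succ_succ (α + 1) x n
    have d2 := gegenbauer_eval_deriv_succ_succ (α + 1) x n
    have s1 := gegenbauer_shift_aux α hα x (n + 1)
    rw [eq_inv_mul_iff_mul_eq₀ (by assumption)] at e3 q2 d2
    push_cast at e3 s1 ⊢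
    refine mul_left_cancel₀ (mul_ne_zero a3 a4) ?_
    linear_combination (-(n + 2 * α + 3) * 2 * (α + 1) * x) * q2
      + ((n + 2 * α + 3) * (1 - x ^ 2)) * d2
      + ((n + 2 * α + 3) * (2 * n + 2 * α + 5) * x) * h1 - ((n + 2 * α + 3) * (n + 1)) * h0
      + (2 * (α + 1) * (n + 2 * α + 4)) * e3 + (2 * n + 2 * α + 5) * s1

/-- Unnormalized Rodrigues formula. -/
theorem gegenbauer_iteratedDeriv (n : ℕ) : ∀ (α : ℝ), -1 < α → ∀ x ∈ Set.Ioo (-1 : ℝ) 1,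
    iteratedDeriv n (fun y : ℝ => (1 - y ^ 2) ^ ((n : ℝ) + α)) x
      = (-1) ^ n * 2 ^ n * (∏ i ∈ Finset.range n, (α + (i + 1))) * (1 - x ^ 2) ^ α
        * (gegenbauer α n).eval x := by
  induction n with
  | zero => intro α hα x hx; simp [gegenbauer]
  | succ n ih =>
    intro α hα x hx
    have hpos : 0 < 1 - x ^ 2 := by nlinarith [hx.1, hx.2]
    rw [iteratedDeriv_succ]
    have hev : iteratedDeriv n (fun y : ℝ => (1 - y ^ 2) ^ (((n + 1 : ℕ) : ℝ) + α)) =ᶠ[nhds x]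
        fun y => (-1) ^ n * 2 ^ n * (∏ i ∈ Finset.range n, (α + 1 + (i + 1))) *
          ((1 - y ^ 2) ^ (α + 1) * (gegenbauer (α + 1) n).eval y) := by
      filter_upwards [isOpen_Ioo.mem_nhds hx] with y hy
      have := ih (α + 1) (by linarith) y hy
      rw [show ((n + 1 : ℕ) : ℝ) + α = n + (α + 1) by push_cast; ring, this]
      ring
    rw [hev.deriv_eq]
    have h1 : HasDerivAt (fun y : ℝ => (1 - y ^ 2) ^ (α + 1))
        (-(2 * x) * (α + 1) * (1 - x ^ 2) ^ α) x := by
      have h := ((hasDerivAt_pow 2 x).const_sub 1).rpow_const (p := α + 1) (Or.inl hpos.ne')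
      simpa using h
    have h2 := ((h1.mul ((gegenbauer (α + 1) n).hasDerivAt x)).const_mul
      ((-1) ^ n * 2 ^ n * (∏ i ∈ Finset.range n, (α + 1 + ((i : ℝ) + 1))))).deriv
    have h3 : (1 - x ^ 2) ^ (α + 1) = (1 - x ^ 2) ^ α * (1 - x ^ 2) := by
      rw [Real.rpow_add hpos, Real.rpow_one]
    have h4 : ∏ i ∈ Finset.range (n + 1), (α + ((i : ℝ) + 1))
        = (∏ i ∈ Finset.range n, (α + 1 + ((i : ℝ) + 1))) * (α + 1) := by
      rw [Finset.prod_range_succ']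
      congr 1
      · refine Finset.prod_congr rfl fun i _ => ?_
        push_cast; ring
      · push_cast; ring
    refine h2.trans ?_
    rw [h3, h4]
    linear_combination (-1) ^ n * 2 ^ n * (∏ i ∈ Finset.range n, (α + 1 + ((i : ℝ) + 1)))
      * (1 - x ^ 2) ^ α * gegenbauer_shift_deriv_aux α hα x n

/-- Rodrigues formula: on `(-1, 1)`, for `α > -1`,
`P_n^{(α)}(x) = (-1)^n / (2^n (α+1)⋯(α+n)) (1-x²)^{-α} (d/dx)^n (1-x²)^{n+α}`. -/
theorem gegenbauer_rodrigues (α : ℝ) (hα : -1 < α) (n : ℕ) (x : ℝ)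
    (hx : x ∈ Set.Ioo (-1 : ℝ) 1) :
    (gegenbauer α n).eval x = (-1) ^ n / (2 ^ n * ∏ i ∈ Finset.range n, (α + (i + 1)))
      * (1 - x ^ 2) ^ (-α) * iteratedDeriv n (fun y : ℝ => (1 - y ^ 2) ^ ((n : ℝ) + α)) x := by
  have hpos : 0 < 1 - x ^ 2 := by nlinarith [hx.1, hx.2]
  have hprod : ∏ i ∈ Finset.range n, (α + ((i : ℝ) + 1)) ≠ 0 :=
    Finset.prod_ne_zero_iff.mpr fun i _ => by
      have : (0 : ℝ) ≤ i := i.cast_nonneg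
      linarith
  have h1 : ((-1 : ℝ) ^ n) * (-1) ^ n = 1 := by rw [← mul_pow]; simp
  have h2 : (1 - x ^ 2) ^ (-α) * (1 - x ^ 2) ^ α = 1 := by
    rw [← Real.rpow_add hpos]; simp
  rw [gegenbauer_iteratedDeriv n α hα x hx]
  field_simp
  linear_combination -(gegenbauer α n).eval x * h2
    - (gegenbauer α n).eval x * (1 - x ^ 2) ^ (-α) * (1 - x ^ 2) ^ α * h1

theorem gegenbauer_degree (α : ℝ) (hα : -1 < α) (n : ℕ) : (gegenbauer α n).degree = n := by
  induction n using Nat.twoStepInduction with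
  | zero => simp [gegenbauer]
  | one => simp [gegenbauer]
  | more n h0 h1 =>
    have hn : (0 : ℝ) ≤ n := n.cast_nonneg
    have a : ((n : ℝ) + 2 * α + 2)⁻¹ ≠ 0 := inv_ne_zero (by linarith)
    have b : (2 * (n : ℝ) + 2 * α + 3) ≠ 0 := by linarith
    have c : ((n : ℝ) + 1) ≠ 0 := by linarith
    have hA : (C (2 * (n : ℝ) + 2 * α + 3) * X * gegenbauer α (n + 1)).degree
        = ((n + 2 : ℕ) : WithBot ℕ) := by
      rw [degree_mul, degree_mul, degree_C b, degree_X, h1]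
      norm_cast
      omega
    have hB : (C ((n : ℝ) + 1) * gegenbauer α n).degree = (n : WithBot ℕ) := by
      rw [degree_mul, degree_C c, h0, zero_add]
    rw [gegenbauer, degree_mul, degree_C a, zero_add, degree_sub_eq_left_of_degree_lt, hA]
    rw [hA, hB]
    exact_mod_cast (by omega : n < n + 2)

/-- For `α ≥ -1/2` the Gegenbauer polynomials form a basis of `ℝ[X]`. -/
def gegenbauerBasis (α : ℝ) (hα : -1 / 2 ≤ α) : Module.Basis ℕ ℝ ℝ[X] :=
  Polynomial.Sequence.basis ⟨gegenbauer α, gegenbauer_degree α (by linarith)⟩ fun i =>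
    (leadingCoeff_ne_zero.mpr (Polynomial.Sequence.ne_zero _ i)).isUnit

theorem gegenbauerBasis_apply (α : ℝ) (hα : -1 / 2 ≤ α) (n : ℕ) :
    gegenbauerBasis α hα n = gegenbauer α n := by
  simp [gegenbauerBasis]

/-- Linearization coefficients: `linCoeff α hα m n k` is the coefficient of `P_k^{(α)}` in the
expansion of the product `P_m^{(α)} P_n^{(α)}` in Gegenbauer polynomials, that is, the mass of
`δ_m ⋆ δ_n` at `k`. -/
def linCoeff (α : ℝ) (hα : -1 / 2 ≤ α) (m n k : ℕ) : ℝ :=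
  (gegenbauerBasis α hα).repr (gegenbauer α m * gegenbauer α n) k

/-- The generalized convolution `μ ⋆ ν = ∑_{m,n} μ(m) ν(n) δ_m ⋆ δ_n` on `ℕ`; a measure on `ℕ` is
given by its masses at points. -/
def conv (α : ℝ) (hα : -1 / 2 ≤ α) (μ ν : ℕ → ℝ) (k : ℕ) : ℝ :=
  ∑' p : ℕ × ℕ, μ p.1 * ν p.2 * linCoeff α hα p.1 p.2 k

/-- One-step transition probability `p(x, y) = (δ_x ⋆ μ)(y)` of the random walk associated with
Gegenbauer polynomials. -/
def step (α : ℝ) (hα : -1 / 2 ≤ α) (μ : PMF ℕ) (x y : ℕ) : ℝ :=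
  conv α hα (Pi.single x 1) (fun n => (μ n).toReal) y

/-- `n`-step transition probability `p^{(n)}(x, y)` of the Markov chain with kernel `step`. -/
def nStep (α : ℝ) (hα : -1 / 2 ≤ α) (μ : PMF ℕ) : ℕ → ℕ → ℕ → ℝ
  | 0, x, y => if x = y then 1 else 0
  | n + 1, x, y => ∑' z, nStep α hα μ n x z * step α hα μ z y

/-- Aperiodicity of the step law: its support lies neither in the even nor in the odd numbers and,
in the case `α = -1/2` (where the walk is a reflected symmetric walk on `ℤ`), in no `dℕ` with
`d ≥ 2` either. -/
def IsAperiodic (α : ℝ) (μ : PMF ℕ) : Prop :=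
  ¬ (μ.support ⊆ {n | Even n}) ∧ ¬ (μ.support ⊆ {n | Odd n}) ∧
    (α = -1 / 2 → ∀ d : ℕ, 2 ≤ d → ¬ (μ.support ⊆ {n | d ∣ n}))

/-- `C = (4(α+1))⁻¹ ∑_{n ≥ 1} μ(n) n (n + 2α + 1)`; the term `n = 0` vanishes. -/
def diffConst (α : ℝ) (μ : PMF ℕ) : ℝ :=
  1 / (4 * (α + 1)) * ∑' n : ℕ, (μ n).toReal * ((n : ℝ) * ((n : ℝ) + 2 * α + 1))

/-- The modified Bessel function of the first kind
`I_α(z) = ∑_k (z/2)^{2k+α} / (k! Γ(k+α+1))`, for `z > 0`. -/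
def besselI (α z : ℝ) : ℝ :=
  ∑' k : ℕ, (z / 2) ^ (2 * (k : ℝ) + α) / ((k.factorial : ℝ) * Real.Gamma ((k : ℝ) + α + 1))

end GegenbauerWalk

end

/-!
The functions `P_k` diagonalise the walk: `δ_k ↦ P_k(t)` is multiplicative for `⋆`, and the `P_k`
are orthogonal on `[-1, 1]` for the weight `(1 - t²) ^ α`, so that
`p⁽ⁿ⁾(x, y) = ‖P_y‖⁻² ∫ φ(t)ⁿ P_x(t) P_y(t) (1 - t²) ^ α dt` with `φ = ∑ₖ μ(k) P_k`. Aperiodicity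
means `|φ| < 1` on `[-1, 1)`, and near `t = 1` the second moment gives `1 - φ(t) ~ 2 C (1 - t)`.
After the substitution `t = cos (s / √n)`, `φ(t)ⁿ → exp (-C s²)`, while `P_x` and `P_y` converge to
Bessel functions when `x` and `y` are of order `√n` (Mehler–Heine). Dominated convergence leaves
Weber's second exponential integral, which is the modified Bessel function of the theorem.
-/

namespace GegenbauerWalk

open MeasureTheory Set
open scoped Real Topology

variable {α : ℝ}

theorem gegenbauer_eval_zero (α x : ℝ) : (gegenbauer α 0).eval x = 1 := by simp [gegenbauer]

theorem gegenbauer_eval_index_one (α x : ℝ) : (gegenbauer α 1).eval x = x := by simp [gegenbauer]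

theorem gegenbauer_eval_recurrence (hα : -1 < α) (x : ℝ) (n : ℕ) :
    (n + 2 * α + 2) * (gegenbauer α (n + 2)).eval x
      = (2 * n + 2 * α + 3) * x * (gegenbauer α (n + 1)).eval x
        - (n + 1) * (gegenbauer α n).eval x := by
  have : (0 : ℝ) ≤ n := n.cast_nonneg
  rw [gegenbauer_eval_succ_succ, mul_inv_cancel_left₀ (by linarith)]

theorem gegenbauer_eval_deriv_recurrence (hα : -1 < α) (x : ℝ) (n : ℕ) :
    (n + 2 * α + 2) * (derivative (gegenbauer α (n + 2))).eval x
      = (2 * n + 2 * α + 3) * ((gegenbauer α (n + 1)).eval x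
          + x * (derivative (gegenbauer α (n + 1))).eval x)
        - (n + 1) * (derivative (gegenbauer α n)).eval x := by
  have : (0 : ℝ) ≤ n := n.cast_nonneg
  rw [gegenbauer_eval_deriv_succ_succ, mul_inv_cancel_left₀ (by linarith)]

theorem gegenbauer_eval_one (hα : -1 < α) (n : ℕ) : (gegenbauer α n).eval 1 = 1 := by
  induction n using Nat.twoStepInduction with
  | zero => exact gegenbauer_eval_zero α 1
  | one => exact gegenbauer_eval_index_one α 1
  | more n h0 h1 =>
    have : (0 : ℝ) ≤ n := n.cast_nonneg
    have recurrence := gegenbauer_eval_recurrence hα 1 n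
    rw [h0, h1] at recurrence
    refine mul_left_cancel₀ (by linarith : (n : ℝ) + 2 * α + 2 ≠ 0) ?_
    linear_combination recurrence

theorem gegenbauer_eval_neg (α x : ℝ) (n : ℕ) :
    (gegenbauer α n).eval (-x) = (-1) ^ n * (gegenbauer α n).eval x := by
  induction n using Nat.twoStepInduction with
  | zero => simp [gegenbauer_eval_zero]
  | one => simp [gegenbauer_eval_index_one]
  | more n h0 h1 =>
    rw [gegenbauer_eval_succ_succ, gegenbauer_eval_succ_succ, h0, h1]
    ring

theorem abs_gegenbauer_eval_abs (α x : ℝ) (n : ℕ) :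
    |(gegenbauer α n).eval (|x|)| = |(gegenbauer α n).eval x| := by
  rcases abs_choice x with h | h <;> rw [h]
  simp [gegenbauer_eval_neg, abs_mul]

theorem gegenbauer_contiguous (hα : -1 < α) (x : ℝ) (n : ℕ) :
    2 * (α + 1) * (gegenbauer α (n + 1)).eval x
      = (n + 2 * α + 3) * (gegenbauer (α + 1) (n + 1)).eval x
        - (n + 1) * x * (gegenbauer (α + 1) n).eval x := by
  induction n using Nat.twoStepInduction with
  | zero =>
    simp only [zero_add, gegenbauer_eval_zero, gegenbauer_eval_index_one]
    push_cast
    ring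
  | one =>
    have p := gegenbauer_eval_recurrence hα x 0
    have q := gegenbauer_eval_recurrence (α := α + 1) (by linarith) x 0
    simp only [Nat.reduceAdd, zero_add, gegenbauer_eval_zero, gegenbauer_eval_index_one] at p q ⊢
    push_cast at p q ⊢
    linear_combination p - q
  | more n h0 h1 =>
    have : (0 : ℝ) ≤ n := n.cast_nonneg
    have p := gegenbauer_eval_recurrence hα x (n + 1)
    have q₂ := gegenbauer_eval_recurrence (α := α + 1) (by linarith) x n
    have q₃ := gegenbauer_eval_recurrence (α := α + 1) (by linarith) x (n + 1)
    push_cast at h1 p q₃ ⊢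
    refine mul_left_cancel₀ (by linarith : (n : ℝ) + 2 * α + 3 ≠ 0) ?_
    linear_combination 2 * (α + 1) * p - (n + 2 * α + 3) * q₃ + (2 * n + 2 * α + 5) * x * h1
      - (n + 2) * h0 + (n + 2) * x * q₂

theorem gegenbauer_contiguous' (hα : -1 < α) (x : ℝ) (n : ℕ) :
    2 * (α + 1) * (gegenbauer α (n + 2)).eval x
      = (n + 2 * α + 3) * x * (gegenbauer (α + 1) (n + 1)).eval x
        - (n + 1) * (gegenbauer (α + 1) n).eval x := by
  have p := gegenbauer_contiguous hα x (n + 1)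
  have q := gegenbauer_eval_recurrence (α := α + 1) (by linarith) x n
  push_cast at p
  linear_combination p + q

/-- The eigenvalue of the ultraspherical differential operator for the eigenfunction
`P_n^{(α)}`. -/
def eigenvalue (α : ℝ) (n : ℕ) : ℝ := n * (n + 2 * α + 1)

theorem eigenvalue_nonneg (hα : -1 / 2 ≤ α) (n : ℕ) : 0 ≤ eigenvalue α n :=
  mul_nonneg n.cast_nonneg (by linarith [(n.cast_nonneg : (0 : ℝ) ≤ n)])

theorem eigenvalue_pos (hα : -1 / 2 ≤ α) {n : ℕ} (hn : n ≠ 0) : 0 < eigenvalue α n := by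
  have : (0 : ℝ) < n := by positivity
  exact mul_pos this (by linarith)

theorem eigenvalue_mono (hα : -1 / 2 ≤ α) : Monotone (eigenvalue α) := fun m n hmn => by
  have : (0 : ℝ) ≤ m + 2 * α + 1 := by linarith [(m.cast_nonneg : (0 : ℝ) ≤ m)]
  simp only [eigenvalue]
  gcongr

theorem eigenvalue_sub_eigenvalue (α : ℝ) (m n : ℕ) :
    eigenvalue α m - eigenvalue α n = (m - n) * (m + n + 2 * α + 1) := by
  simp only [eigenvalue]
  ring

theorem eigenvalue_injective (hα : -1 / 2 ≤ α) : Function.Injective (eigenvalue α) := by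
  intro m n h
  rw [← sub_eq_zero, eigenvalue_sub_eigenvalue, mul_eq_zero, sub_eq_zero, Nat.cast_inj] at h
  refine h.elim id fun h => ?_
  have : (0 : ℝ) ≤ m := m.cast_nonneg
  have : (0 : ℝ) ≤ n := n.cast_nonneg
  exact Nat.cast_injective (R := ℝ) (by linarith)

theorem gegenbauer_eval_derivative (hα : -1 < α) (x : ℝ) (n : ℕ) :
    2 * (α + 1) * (derivative (gegenbauer α (n + 1))).eval x
      = eigenvalue α (n + 1) * (gegenbauer (α + 1) n).eval x := by
  simp only [eigenvalue]
  induction n using Nat.twoStepInduction with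
  | zero => simp [gegenbauer]; ring
  | one =>
    have recurrence := gegenbauer_eval_deriv_recurrence hα x 0
    simp [gegenbauer] at recurrence ⊢
    linear_combination recurrence
  | more n h0 h1 =>
    have : (0 : ℝ) ≤ n := n.cast_nonneg
    have p := gegenbauer_eval_deriv_recurrence hα x (n + 1)
    have q := gegenbauer_eval_recurrence (α := α + 1) (by linarith) x n
    have contiguous := gegenbauer_contiguous' hα x n
    push_cast at p h0 h1 ⊢
    refine mul_left_cancel₀ (by linarith : (n : ℝ) + 2 * α + 3 ≠ 0) ?_
    linear_combination 2 * (α + 1) * p + (2 * n + 2 * α + 5) * contiguous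
      + (2 * n + 2 * α + 5) * x * h1 - (n + 2) * h0 - (n + 3) * (n + 2 * α + 3) * q

theorem derivative_gegenbauer (hα : -1 < α) (n : ℕ) :
    derivative (gegenbauer α (n + 1))
      = C (eigenvalue α (n + 1) / (2 * (α + 1))) * gegenbauer (α + 1) n := by
  refine Polynomial.funext fun x => ?_
  rw [eval_mul, eval_C, div_mul_eq_mul_div, eq_div_iff (by linarith), mul_comm]
  exact gegenbauer_eval_derivative hα x n

theorem gegenbauer_ode (hα : -1 < α) (x : ℝ) (n : ℕ) :
    eigenvalue α n * (gegenbauer α n).eval x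
      = 2 * (α + 1) * x * (derivative (gegenbauer α n)).eval x
        - (1 - x ^ 2) * (derivative (derivative (gegenbauer α n))).eval x := by
  cases n with
  | zero => simp [gegenbauer, eigenvalue]
  | succ n =>
    rw [derivative_gegenbauer hα, derivative_C_mul, eval_mul, eval_mul, eval_C]
    have cancel : eigenvalue α (n + 1) / (2 * (α + 1)) * (2 * (α + 1)) = eigenvalue α (n + 1) :=
      div_mul_cancel₀ _ (by linarith)
    linear_combination
      eigenvalue α (n + 1) / (2 * (α + 1)) * gegenbauer_shift_deriv_aux α hα x n
        - (gegenbauer α (n + 1)).eval x * cancel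

theorem derivative_gegenbauer_eval_one (hα : -1 < α) (n : ℕ) :
    (derivative (gegenbauer α n)).eval 1 = eigenvalue α n / (2 * (α + 1)) := by
  have ode := gegenbauer_ode hα 1 n
  rw [gegenbauer_eval_one hα] at ode
  rw [eq_div_iff (by linarith)]
  linear_combination -ode

theorem iterate_derivative_gegenbauer_eval_one (hα : -1 < α) (n k : ℕ) :
    (derivative^[k] (gegenbauer α n)).eval 1
      = ∏ i ∈ Finset.range k, (eigenvalue α n - eigenvalue α i) / (2 * (α + 1 + i)) := by
  induction k generalizing α n with
  | zero => simp [gegenbauer_eval_one hα]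
  | succ k ih =>
    rw [Function.iterate_succ_apply, Finset.prod_range_succ', mul_comm]
    cases n with
    | zero => simp [gegenbauer, eigenvalue]
    | succ n =>
      rw [derivative_gegenbauer hα, ← smul_eq_C_mul, iterate_derivative_smul, eval_smul,
        ih (by linarith) n, smul_eq_mul]
      congr 1
      · simp [eigenvalue]
      · refine Finset.prod_congr rfl fun i _ => ?_
        simp only [eigenvalue]
        push_cast
        congr 1 <;> ring

/-- The Taylor expansion at `1`, written as an infinite series: the factor `i = n` makes the terms
with `k > n` vanish. -/
theorem gegenbauer_eval_eq_tsum (hα : -1 < α) (n : ℕ) (x : ℝ) :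
    (gegenbauer α n).eval x = ∑' k : ℕ, (∏ i ∈ Finset.range k,
      (eigenvalue α n - eigenvalue α i) * (x - 1) / (2 * (α + 1 + i))) / (k.factorial : ℝ) := by
  have natDegree : (taylor 1 (gegenbauer α n)).natDegree = n := by
    rw [natDegree_taylor, natDegree_eq_of_degree_eq_some (gegenbauer_degree α hα n)]
  have taylor_eval := Polynomial.taylor_eval 1 (gegenbauer α n) (x - 1)
  rw [sub_add_cancel] at taylor_eval
  rw [← taylor_eval, eval_eq_sum_range, natDegree, tsum_eq_sum (s := Finset.range (n + 1))]
  · refine Finset.sum_congr rfl fun k _ => ?_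
    have iterate_derivative : (derivative^[k] (gegenbauer α n)).eval 1
        = k.factorial * (hasseDeriv k (gegenbauer α n)).eval 1 := by
      simp [← factorial_smul_hasseDeriv]
    simp_rw [mul_div_right_comm _ (x - 1)]
    rw [Finset.prod_mul_distrib, ← iterate_derivative_gegenbauer_eval_one hα, iterate_derivative,
      taylor_coeff, Finset.prod_const, Finset.card_range]
    field_simp
  · intro k hk
    rw [Finset.prod_eq_zero (i := n) (Finset.mem_range.2 (by simpa using hk)) (by simp),
      zero_div]

/-- Sonin's function, whose monotonicity on `[0, 1]` bounds the Gegenbauer polynomials. -/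
noncomputable def sonin (α : ℝ) (n : ℕ) (x : ℝ) : ℝ :=
  eigenvalue α n * (gegenbauer α n).eval x ^ 2
    + (1 - x ^ 2) * (derivative (gegenbauer α n)).eval x ^ 2

theorem hasDerivAt_sonin (hα : -1 < α) (n : ℕ) (x : ℝ) :
    HasDerivAt (sonin α n)
      (2 * (2 * α + 1) * x * (derivative (gegenbauer α n)).eval x ^ 2) x := by
  have square := (((gegenbauer α n).hasDerivAt x).fun_pow 2).const_mul (eigenvalue α n)
  have weighted := ((hasDerivAt_pow 2 x).const_sub 1).fun_mul
    (((derivative (gegenbauer α n)).hasDerivAt x).fun_pow 2)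
  refine (square.add weighted).congr_deriv ?_
  push_cast
  linear_combination 2 * (derivative (gegenbauer α n)).eval x * gegenbauer_ode hα x n

theorem sonin_one (hα : -1 < α) (n : ℕ) : sonin α n 1 = eigenvalue α n := by
  simp [sonin, gegenbauer_eval_one hα]

theorem eigenvalue_mul_sq_le_sonin (α : ℝ) (n : ℕ) {x : ℝ} (hx : |x| ≤ 1) :
    eigenvalue α n * (gegenbauer α n).eval x ^ 2 ≤ sonin α n x :=
  le_add_of_nonneg_right <|
    mul_nonneg (sub_nonneg.2 ((sq_le_one_iff_abs_le_one x).2 hx)) (sq_nonneg _)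

theorem sonin_one_sub_sonin (hα : -1 < α) (n : ℕ) (x : ℝ) :
    sonin α n 1 - sonin α n x
      = ∫ y in x..1, 2 * (2 * α + 1) * y * (derivative (gegenbauer α n)).eval y ^ 2 :=
  (intervalIntegral.integral_eq_sub_of_hasDerivAt (fun y _ => hasDerivAt_sonin hα n y)
    (by apply Continuous.intervalIntegrable; fun_prop)).symm

theorem sonin_le_eigenvalue (hα : -1 / 2 ≤ α) (n : ℕ) {x : ℝ} (hx : x ∈ Icc 0 1) :
    sonin α n x ≤ eigenvalue α n := by
  rw [← sonin_one (by linarith), ← sub_nonneg, sonin_one_sub_sonin (by linarith)]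
  refine intervalIntegral.integral_nonneg hx.2 fun y hy => ?_
  have : 0 ≤ 2 * α + 1 := by linarith
  have : 0 ≤ y := hx.1.trans hy.1
  positivity

theorem sonin_lt_eigenvalue (hα : -1 / 2 < α) {n : ℕ} (hn : n ≠ 0) {x : ℝ} (hx : x ∈ Ico 0 1) :
    sonin α n x < eigenvalue α n := by
  rw [← sonin_one (by linarith), ← sub_pos, sonin_one_sub_sonin (by linarith)]
  have : 0 < 2 * α + 1 := by linarith
  refine intervalIntegral.integral_pos hx.2 (by fun_prop) (fun y hy => ?_)
    ⟨1, right_mem_Icc.2 hx.2.le, ?_⟩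
  · have : 0 ≤ y := hx.1.trans hy.1.le
    positivity
  · have := eigenvalue_pos hα.le hn
    rw [derivative_gegenbauer_eval_one (by linarith)]
    have : 0 < α + 1 := by linarith
    positivity

theorem abs_gegenbauer_eval_le_one (hα : -1 / 2 ≤ α) (n : ℕ) {x : ℝ} (hx : |x| ≤ 1) :
    |(gegenbauer α n).eval x| ≤ 1 := by
  rcases eq_or_ne n 0 with rfl | hn
  · simp [gegenbauer_eval_zero]
  rw [← abs_gegenbauer_eval_abs, ← sq_le_one_iff_abs_le_one]
  refine le_of_mul_le_mul_left ?_ (eigenvalue_pos hα hn)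
  rw [mul_one]
  exact (eigenvalue_mul_sq_le_sonin α n ((abs_abs x).trans_le hx)).trans
    (sonin_le_eigenvalue hα n ⟨abs_nonneg x, hx⟩)

theorem abs_gegenbauer_eval_lt_one (hα : -1 / 2 < α) {n : ℕ} (hn : n ≠ 0) {x : ℝ}
    (hx : |x| < 1) : |(gegenbauer α n).eval x| < 1 := by
  rw [← abs_gegenbauer_eval_abs, ← sq_lt_one_iff_abs_lt_one]
  refine lt_of_mul_lt_mul_left ?_ (eigenvalue_nonneg hα.le n)
  rw [mul_one]
  exact (eigenvalue_mul_sq_le_sonin α n ((abs_abs x).trans_le hx.le)).trans_lt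
    (sonin_lt_eigenvalue hα hn ⟨abs_nonneg x, hx⟩)

theorem abs_derivative_gegenbauer_eval_le (hα : -1 / 2 ≤ α) (n : ℕ) {x : ℝ} (hx : |x| ≤ 1) :
    |(derivative (gegenbauer α n)).eval x| ≤ eigenvalue α n / (2 * (α + 1)) := by
  cases n with
  | zero => simp [gegenbauer, eigenvalue]
  | succ n =>
    have : 0 ≤ eigenvalue α (n + 1) / (2 * (α + 1)) :=
      div_nonneg (eigenvalue_nonneg hα _) (by linarith)
    rw [derivative_gegenbauer (by linarith), eval_mul, eval_C, abs_mul, abs_of_nonneg this]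
    exact mul_le_of_le_one_right this (abs_gegenbauer_eval_le_one (by linarith) n hx)

theorem abs_one_sub_gegenbauer_eval_le (hα : -1 / 2 ≤ α) (n : ℕ) {x : ℝ} (hx : x ∈ Icc (-1) 1) :
    |1 - (gegenbauer α n).eval x| ≤ eigenvalue α n / (2 * (α + 1)) * (1 - x) := by
  have h := (convex_Icc (-1 : ℝ) 1).norm_image_sub_le_of_norm_deriv_le
    (f := fun y => (gegenbauer α n).eval y) (fun y _ => (gegenbauer α n).differentiableAt)
    (fun y hy => by
      rw [Polynomial.deriv]
      exact abs_derivative_gegenbauer_eval_le hα n (abs_le.2 hy)) hx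
    (right_mem_Icc.2 (by norm_num))
  rwa [gegenbauer_eval_one (by linarith), Real.norm_eq_abs, Real.norm_eq_abs,
    abs_of_nonneg (sub_nonneg.2 hx.2)] at h

/-- The orthogonality measure `(1 - t²)^α dt` of the Gegenbauer polynomials on `[-1, 1]`. -/
noncomputable def gegenbauerMeasure (α : ℝ) : Measure (Icc (-1 : ℝ) 1) :=
  (Measure.comap Subtype.val volume).withDensity fun t => ENNReal.ofReal ((1 - t.1 ^ 2) ^ α)

theorem measurable_gegenbauerWeight (α : ℝ) :
    Measurable fun t : Icc (-1 : ℝ) 1 => (1 - t.1 ^ 2) ^ α := by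
  fun_prop

theorem integral_gegenbauerMeasure_eq_setIntegral (α : ℝ) (f : ℝ → ℝ) :
    ∫ t, f t ∂gegenbauerMeasure α = ∫ t in Icc (-1) 1, (1 - t ^ 2) ^ α * f t := by
  rw [gegenbauerMeasure, integral_withDensity_eq_integral_toReal_smul
    (measurable_gegenbauerWeight α).ennreal_ofReal (by simp),
    ← integral_subtype measurableSet_Icc fun t => (1 - t ^ 2) ^ α * f t]
  refine integral_congr_ae (ae_of_all _ fun t => ?_)
  have : 0 ≤ 1 - t.1 ^ 2 := by nlinarith [t.2.1, t.2.2]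
  dsimp only
  rw [ENNReal.toReal_ofReal (by positivity), smul_eq_mul]

theorem abs_neg_sin_mul_one_sub_cos_sq_rpow (α : ℝ) {θ : ℝ} (hθ : θ ∈ Ioo 0 π) :
    |-Real.sin θ| * (1 - Real.cos θ ^ 2) ^ α = Real.sin θ ^ (2 * α + 1) := by
  have sin_pos : 0 < Real.sin θ := Real.sin_pos_of_mem_Ioo hθ
  rw [abs_neg, abs_of_pos sin_pos, ← Real.sin_sq, ← Real.rpow_two, ← Real.rpow_mul sin_pos.le,
    Real.rpow_add_one sin_pos.ne', mul_comm]

theorem integral_gegenbauerMeasure (α : ℝ) (f : ℝ → ℝ) :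
    ∫ t, f t ∂gegenbauerMeasure α = ∫ θ in 0..π, Real.sin θ ^ (2 * α + 1) * f (Real.cos θ) := by
  rw [integral_gegenbauerMeasure_eq_setIntegral, ← Real.bijOn_cos.image_eq,
    integral_image_eq_integral_abs_deriv_smul measurableSet_Icc
      (fun θ _ => (Real.hasDerivAt_cos θ).hasDerivWithinAt) Real.injOn_cos,
    intervalIntegral.integral_of_le Real.pi_nonneg, integral_Icc_eq_integral_Ioo,
    integral_Ioc_eq_integral_Ioo]
  refine setIntegral_congr_fun measurableSet_Ioo fun θ hθ => ?_
  rw [smul_eq_mul, ← mul_assoc, abs_neg_sin_mul_one_sub_cos_sq_rpow α hθ]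

theorem continuous_sin_rpow (hα : -1 / 2 ≤ α) :
    Continuous fun θ => Real.sin θ ^ (2 * α + 1) :=
  Real.continuous_sin.rpow_const fun _ => Or.inr (by linarith)

theorem isFiniteMeasure_gegenbauerMeasure (hα : -1 / 2 ≤ α) :
    IsFiniteMeasure (gegenbauerMeasure α) := by
  refine isFiniteMeasure_withDensity_ofReal (Integrable.hasFiniteIntegral ?_)
  have integrableOn : IntegrableOn (fun t : ℝ => (1 - t ^ 2) ^ α) (Icc (-1) 1) := by
    rw [← Real.bijOn_cos.image_eq, integrableOn_image_iff_integrableOn_abs_deriv_smul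
      measurableSet_Icc (fun θ _ => (Real.hasDerivAt_cos θ).hasDerivWithinAt) Real.injOn_cos,
      integrableOn_Icc_iff_integrableOn_Ioo]
    refine ((continuous_sin_rpow hα).integrableOn_Icc.mono_set Ioo_subset_Icc_self).congr_fun
      (fun θ hθ => ?_) measurableSet_Ioo
    exact (abs_neg_sin_mul_one_sub_cos_sq_rpow α hθ).symm
  exact (integrableOn_iff_comap_subtypeVal measurableSet_Icc).1 integrableOn

theorem integrable_gegenbauerMeasure (hα : -1 / 2 ≤ α) {f : Icc (-1 : ℝ) 1 → ℝ}
    (hf : Continuous f) : Integrable f (gegenbauerMeasure α) :=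
  have := isFiniteMeasure_gegenbauerMeasure hα
  BoundedContinuousFunction.integrable _ (BoundedContinuousFunction.mkOfCompact ⟨f, hf⟩)

theorem hasDerivAt_sin_rpow_mul_eval_cos (hα : -1 / 2 ≤ α) (Q : ℝ[X]) {θ : ℝ}
    (hθ : θ ∈ Icc 0 π) :
    HasDerivAt (fun θ => Real.sin θ ^ (2 * α + 2) * Q.eval (Real.cos θ))
      (Real.sin θ ^ (2 * α + 1) * (2 * (α + 1) * Real.cos θ * Q.eval (Real.cos θ)
        - (1 - Real.cos θ ^ 2) * (derivative Q).eval (Real.cos θ))) θ := by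
  have weight := (Real.hasDerivAt_sin θ).rpow_const (p := 2 * α + 2) (Or.inr (by linarith))
  have polynomial := (Q.hasDerivAt (Real.cos θ)).comp θ (Real.hasDerivAt_cos θ)
  refine (weight.mul polynomial).congr_deriv ?_
  have rpow_succ : Real.sin θ ^ (2 * α + 2) = Real.sin θ ^ (2 * α + 1) * Real.sin θ := by
    rw [← Real.rpow_add_one' (Real.sin_nonneg_of_mem_Icc hθ) (by linarith)]
    ring_nf
  rw [rpow_succ, ← Real.sin_sq, show 2 * α + 2 - 1 = 2 * α + 1 by ring]
  simp only [Function.comp_apply]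
  ring

theorem integral_eval_sub_derivative (hα : -1 / 2 ≤ α) (Q : ℝ[X]) :
    ∫ t : Icc (-1 : ℝ) 1, 2 * (α + 1) * t.1 * Q.eval t.1
      - (1 - t.1 ^ 2) * (derivative Q).eval t.1 ∂gegenbauerMeasure α = 0 := by
  rw [integral_gegenbauerMeasure α fun t =>
    2 * (α + 1) * t * Q.eval t - (1 - t ^ 2) * (derivative Q).eval t,
    intervalIntegral.integral_eq_sub_of_hasDerivAt
      (f := fun θ => Real.sin θ ^ (2 * α + 2) * Q.eval (Real.cos θ))]
  · simp [Real.zero_rpow (by linarith : 2 * α + 2 ≠ 0)]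
  · intro θ hθ
    rw [uIcc_of_le Real.pi_nonneg] at hθ
    exact hasDerivAt_sin_rpow_mul_eval_cos hα Q hθ
  · have := continuous_sin_rpow hα
    have := Q.continuous
    have := (derivative Q).continuous
    apply Continuous.intervalIntegrable
    fun_prop

theorem integral_gegenbauer_mul_of_ne (hα : -1 / 2 ≤ α) {m n : ℕ} (hmn : m ≠ n) :
    ∫ t : Icc (-1 : ℝ) 1, (gegenbauer α m).eval t.1 * (gegenbauer α n).eval t.1
      ∂gegenbauerMeasure α = 0 := by
  -- Green's identity for the ultraspherical operator, whose eigenvalues are distinct.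
  have green := integral_eval_sub_derivative hα
    (derivative (gegenbauer α m) * gegenbauer α n - gegenbauer α m * derivative (gegenbauer α n))
  refine (mul_eq_zero.1 ((integral_const_mul _ _).symm.trans (Eq.trans ?_ green))).resolve_left
    (sub_ne_zero.2 ((eigenvalue_injective hα).ne hmn))
  refine integral_congr_ae (ae_of_all _ fun t => ?_)
  simp only [eval_sub, eval_mul, eval_add, derivative_sub, derivative_mul]
  have hα' : -1 < α := by linarith
  linear_combination (gegenbauer α n).eval t.1 * gegenbauer_ode hα' t.1 m
    - (gegenbauer α m).eval t.1 * gegenbauer_ode hα' t.1 n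

theorem integral_gegenbauer_recurrence (hα : -1 / 2 ≤ α) (n : ℕ) (Q : ℝ[X]) :
    (2 * n + 2 * α + 3) * ∫ t : Icc (-1 : ℝ) 1,
        t.1 * (gegenbauer α (n + 1)).eval t.1 * Q.eval t.1 ∂gegenbauerMeasure α
      = (n + 1) * (∫ t : Icc (-1 : ℝ) 1, (gegenbauer α n).eval t.1 * Q.eval t.1
          ∂gegenbauerMeasure α)
        + (n + 2 * α + 2) * ∫ t : Icc (-1 : ℝ) 1, (gegenbauer α (n + 2)).eval t.1 * Q.eval t.1
          ∂gegenbauerMeasure α := by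
  have hα' : -1 < α := by linarith
  simp_rw [← integral_const_mul]
  rw [← integral_add (integrable_gegenbauerMeasure hα (by fun_prop))
    (integrable_gegenbauerMeasure hα (by fun_prop))]
  refine integral_congr_ae (ae_of_all _ fun t => ?_)
  linear_combination -Q.eval t.1 * gegenbauer_eval_recurrence hα' t.1 n

/-- The squared norm of `P_n^{(α)}` in `L²` of the orthogonality measure. -/
noncomputable def sqNorm (α : ℝ) (n : ℕ) : ℝ :=
  ∫ t : Icc (-1 : ℝ) 1, (gegenbauer α n).eval t.1 * (gegenbauer α n).eval t.1
    ∂gegenbauerMeasure α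

theorem sqNorm_one (hα : -1 / 2 ≤ α) : (2 * α + 3) * sqNorm α 1 = sqNorm α 0 := by
  have recurrence := integral_gegenbauer_recurrence hα 0 (gegenbauer α 0)
  rw [integral_gegenbauer_mul_of_ne hα (m := 0 + 2) (n := 0) (by simp)] at recurrence
  simp only [sqNorm, zero_add, gegenbauer_eval_zero, gegenbauer_eval_index_one] at recurrence ⊢
  push_cast at recurrence
  simpa only [mul_one, one_mul, mul_zero, zero_add, add_zero] using recurrence

theorem sqNorm_succ_succ (hα : -1 / 2 ≤ α) (n : ℕ) :
    (n + 2 * α + 2) * (2 * n + 2 * α + 5) * sqNorm α (n + 2)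
      = (2 * n + 2 * α + 3) * (n + 2) * sqNorm α (n + 1) := by
  have lower := integral_gegenbauer_recurrence hα n (gegenbauer α (n + 2))
  have upper := integral_gegenbauer_recurrence hα (n + 1) (gegenbauer α (n + 1))
  rw [integral_gegenbauer_mul_of_ne hα (m := n) (n := n + 2) (by omega)] at lower
  rw [integral_gegenbauer_mul_of_ne hα (m := n + 1 + 2) (n := n + 1) (by omega)] at upper
  simp_rw [mul_right_comm _ ((gegenbauer α (n + 1 + 1)).eval _)] at upper
  push_cast at upper
  simp only [sqNorm]
  linear_combination -(2 * n + 2 * α + 5) * lower + (2 * n + 2 * α + 3) * upper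

theorem sqNorm_succ (hα : -1 / 2 ≤ α) (n : ℕ) :
    sqNorm α (n + 1) = sqNorm α 0 * (n + 1).factorial
      / ((2 * n + 2 * α + 3) * ∏ j ∈ Finset.range n, (2 * α + 2 + j)) := by
  have : 0 < 2 * α + 2 := by linarith
  have prod_pos (n : ℕ) : 0 < ∏ j ∈ Finset.range n, (2 * α + 2 + j) :=
    Finset.prod_pos fun j _ => by positivity
  have factor_pos (n : ℕ) : 0 < 2 * n + 2 * α + 3 := by linarith [(n.cast_nonneg : (0 : ℝ) ≤ n)]
  rw [eq_div_iff (mul_pos (factor_pos n) (prod_pos n)).ne']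
  induction n with
  | zero => simpa [mul_comm] using sqNorm_one hα
  | succ n ih =>
    have recurrence := sqNorm_succ_succ hα n
    rw [Finset.prod_range_succ, Nat.factorial_succ (n + 1)]
    push_cast
    refine mul_left_cancel₀ (factor_pos n).ne' ?_
    linear_combination (∏ j ∈ Finset.range n, (2 * α + 2 + j)) * (2 * n + 2 * α + 3) * recurrence
      + (2 * n + 2 * α + 3) * (n + 2) * ih

theorem sqNorm_zero (α : ℝ) :
    sqNorm α 0 = ∫ t in Icc (-1) 1, (1 - t ^ 2) ^ α := by
  simp only [sqNorm, gegenbauer_eval_zero]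
  simpa using integral_gegenbauerMeasure_eq_setIntegral α fun _ => 1

theorem integral_rpow_mul_one_sub_rpow {a b : ℝ} (ha : 0 < a) (hb : 0 < b) :
    ∫ x in (0 : ℝ)..1, x ^ (a - 1) * (1 - x) ^ (b - 1)
      = Real.Gamma a * Real.Gamma b / Real.Gamma (a + b) := by
  have betaIntegral := Complex.betaIntegral_eq_Gamma_mul_div (u := a) (v := b) (by simpa) (by simpa)
  rw [← Complex.ofReal_add] at betaIntegral
  simp only [Complex.Gamma_ofReal] at betaIntegral
  rw [← Complex.ofReal_inj, ← intervalIntegral.integral_ofReal]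
  push_cast
  rw [← betaIntegral, Complex.betaIntegral]
  refine intervalIntegral.integral_congr fun x hx => ?_
  rw [uIcc_of_le zero_le_one] at hx
  simp [Complex.ofReal_cpow hx.1, Complex.ofReal_cpow (sub_nonneg.2 hx.2)]

theorem sqNorm_zero_eq_Gamma (hα : -1 < α) :
    sqNorm α 0 = 2 ^ (2 * α + 1) * Real.Gamma (α + 1) ^ 2 / Real.Gamma (2 * α + 2) := by
  have beta := integral_rpow_mul_one_sub_rpow (a := α + 1) (b := α + 1) (by linarith) (by linarith)
  have subst := intervalIntegral.integral_comp_mul_sub (a := 0) (b := 1)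
    (fun t : ℝ => (1 - t ^ 2) ^ α) two_ne_zero 1
  have integrand : EqOn (fun x : ℝ => (1 - (2 * x - 1) ^ 2) ^ α)
      (fun x => 4 ^ α * (x ^ (α + 1 - 1) * (1 - x) ^ (α + 1 - 1))) (uIcc 0 1) := by
    intro x hx
    rw [uIcc_of_le zero_le_one] at hx
    have : 0 ≤ 1 - x := sub_nonneg.2 hx.2
    dsimp only
    rw [add_sub_cancel_right, ← Real.mul_rpow hx.1 this, ← Real.mul_rpow (by norm_num)
      (mul_nonneg hx.1 this)]
    ring_nf
  rw [intervalIntegral.integral_congr integrand, intervalIntegral.integral_const_mul, beta] at subst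
  rw [sqNorm_zero, integral_Icc_eq_integral_Ioc,
    ← intervalIntegral.integral_of_le (by norm_num)]
  have four_rpow : (2 : ℝ) ^ (2 * α + 1) = 2 * 4 ^ α := by
    rw [Real.rpow_add_one two_ne_zero, Real.rpow_mul two_pos.le, mul_comm]
    norm_num
  norm_num at subst
  rw [four_rpow]
  ring_nf at subst ⊢
  linear_combination -2 * subst

theorem sqNorm_pos (hα : -1 / 2 ≤ α) (n : ℕ) : 0 < sqNorm α n := by
  have : 0 < 2 * α + 2 := by linarith
  have : 0 < α + 1 := by linarith
  have zero_pos : 0 < sqNorm α 0 := by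
    rw [sqNorm_zero_eq_Gamma (by linarith)]
    positivity
  cases n with
  | zero => exact zero_pos
  | succ n =>
    rw [sqNorm_succ hα]
    have : 0 < 2 * n + 2 * α + 3 := by linarith [(n.cast_nonneg : (0 : ℝ) ≤ n)]
    have : 0 < ∏ j ∈ Finset.range n, (2 * α + 2 + j) := Finset.prod_pos fun j _ => by positivity
    positivity

theorem inv_sqNorm_succ_div_rpow (hα : -1 / 2 ≤ α) {n : ℕ} (hn : n ≠ 0) :
    (sqNorm α (n + 1))⁻¹ / ((n + 1 : ℕ) : ℝ) ^ (2 * α + 1)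
      = (sqNorm α 0)⁻¹ * ((Real.GammaSeq (2 * α + 2) n)⁻¹
        * (2 - (2 * α + 1) / (n + (2 * α + 2))) * (n / (n + 1)) ^ (2 * α + 2)) := by
  have n_pos : (0 : ℝ) < n := by positivity
  have : 0 < α + 1 := by linarith
  have : 0 < 2 * α + 2 := by linarith
  have : 0 < 2 * n + 2 * α + 3 := by linarith
  have : 0 < ∏ j ∈ Finset.range n, (2 * α + 2 + j) := Finset.prod_pos fun j _ => by positivity
  have rpow_succ : ((n : ℝ) + 1) ^ (2 * α + 2) = (n + 1) ^ (2 * α + 1) * (n + 1) := by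
    rw [← Real.rpow_add_one (by positivity)]
    ring_nf
  have := sqNorm_pos hα 0
  have ratio : 2 - (2 * α + 1) / (n + (2 * α + 2)) = (2 * n + 2 * α + 3) / (2 * α + 2 + n) := by
    rw [add_comm (n : ℝ), sub_div' (by positivity)]
    ring_nf
  rw [sqNorm_succ hα, Real.GammaSeq, Finset.prod_range_succ, Nat.factorial_succ,
    ratio,
    Real.div_rpow n_pos.le (by positivity), rpow_succ]
  push_cast
  field_simp

theorem tendsto_inv_sqNorm_div_rpow (hα : -1 / 2 ≤ α) :
    Tendsto (fun n : ℕ => (sqNorm α n)⁻¹ / (n : ℝ) ^ (2 * α + 1)) atTop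
      (𝓝 (2 / (2 ^ (2 * α + 1) * Real.Gamma (α + 1) ^ 2))) := by
  have Gamma_pos : 0 < Real.Gamma (2 * α + 2) := Real.Gamma_pos_of_pos (by linarith)
  have ratio : Tendsto (fun n : ℕ => 2 - (2 * α + 1) / ((n : ℝ) + (2 * α + 2))) atTop
      (𝓝 (2 - 0)) :=
    tendsto_const_nhds.sub (tendsto_const_nhds.div_atTop
      (tendsto_atTop_add_const_right _ _ tendsto_natCast_atTop_atTop))
  have power : Tendsto (fun n : ℕ => ((n : ℝ) / (n + 1)) ^ (2 * α + 2)) atTop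
      (𝓝 (1 ^ (2 * α + 2))) :=
    (tendsto_natCast_div_add_atTop (1 : ℝ)).rpow_const (Or.inl one_ne_zero)
  have limit := ((((Real.GammaSeq_tendsto_Gamma (2 * α + 2)).inv₀ Gamma_pos.ne').mul ratio).mul
    power).const_mul (sqNorm α 0)⁻¹
  rw [← tendsto_add_atTop_iff_nat 1]
  convert limit.congr' ?_ using 2
  · have : 0 < Real.Gamma (α + 1) := Real.Gamma_pos_of_pos (by linarith)
    rw [sqNorm_zero_eq_Gamma (by linarith), Real.one_rpow, sub_zero, mul_one]
    generalize Real.Gamma (2 * α + 2) = G at Gamma_pos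
    field_simp
  · filter_upwards [eventually_ne_atTop 0] with n hn
    exact (inv_sqNorm_succ_div_rpow hα hn).symm

theorem hasSum_inner_mul_inner_of_orthogonal {E ι : Type*} [NormedAddCommGroup E]
    [InnerProductSpace ℝ E] [CompleteSpace E] {v : ι → E}
    (orthogonal : Pairwise fun i j => inner ℝ (v i) (v j) = 0) (ne_zero : ∀ i, v i ≠ 0)
    (total : (Submodule.span ℝ (range v)).topologicalClosure = ⊤) (x y : E) :
    HasSum (fun i => (inner ℝ (v i) (v i))⁻¹ * inner ℝ x (v i) * inner ℝ (v i) y)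
      (inner ℝ x y) := by
  have norm_ne_zero (i : ι) : ‖v i‖ ≠ 0 := norm_ne_zero_iff.2 (ne_zero i)
  set e : ι → E := fun i => ‖v i‖⁻¹ • v i
  have orthonormal : Orthonormal ℝ e := by
    refine ⟨fun i => ?_, fun i j hij => ?_⟩
    · rw [norm_smul, norm_inv, norm_norm, inv_mul_cancel₀ (norm_ne_zero i)]
    · have inner_eq_zero : inner ℝ (v i) (v j) = 0 := orthogonal hij
      simp only [e, inner_smul_left, inner_smul_right, inner_eq_zero, mul_zero]
  have span_le : Submodule.span ℝ (range v) ≤ Submodule.span ℝ (range e) := by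
    refine Submodule.span_le.2 (range_subset_iff.2 fun i => ?_)
    rw [← smul_inv_smul₀ (norm_ne_zero i) (v i)]
    exact Submodule.smul_mem _ _ (Submodule.subset_span (mem_range_self i))
  have dense : ⊤ ≤ (Submodule.span ℝ (range e)).topologicalClosure :=
    total.ge.trans (Submodule.topologicalClosure_mono span_le)
  refine ((HilbertBasis.mk orthonormal dense).hasSum_inner_mul_inner x y).congr_fun fun i => ?_
  rw [HilbertBasis.coe_mk, inner_smul_left, inner_smul_right, real_inner_self_eq_norm_sq,
    conj_trivial]
  ring

theorem hasSum_integral_mul_integral_of_orthogonal {X ι : Type*} [TopologicalSpace X]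
    [CompactSpace X] [NormalSpace X] [MeasurableSpace X] [BorelSpace X] {ν : Measure X}
    [IsFiniteMeasure ν] [ν.WeaklyRegular] {p : ι → C(X, ℝ)}
    (orthogonal : Pairwise fun i j => ∫ x, p i x * p j x ∂ν = 0)
    (sq_pos : ∀ i, 0 < ∫ x, p i x * p i x ∂ν)
    (total : (Submodule.span ℝ (range p)).topologicalClosure = ⊤) (f g : C(X, ℝ)) :
    HasSum (fun i => (∫ x, p i x * p i x ∂ν)⁻¹ * (∫ x, p i x * f x ∂ν) * ∫ x, p i x * g x ∂ν)
      (∫ x, f x * g x ∂ν) := by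
  set toLp : C(X, ℝ) →L[ℝ] Lp ℝ 2 ν := ContinuousMap.toLp 2 ν ℝ
  have inner_toLp (f g : C(X, ℝ)) : inner ℝ (toLp f) (toLp g) = ∫ x, f x * g x ∂ν := by
    simp only [toLp, ContinuousMap.inner_toLp, conj_trivial, mul_comm (g _)]
  have total_toLp : (Submodule.span ℝ (range fun i => toLp (p i))).topologicalClosure = ⊤ := by
    have map_total := (ContinuousMap.toLp_denseRange (p := 2) ℝ ν ℝ
      ENNReal.ofNat_ne_top).topologicalClosure_map_submodule total
    rwa [Submodule.map_span, ← range_comp] at map_total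
  have parseval := hasSum_inner_mul_inner_of_orthogonal
    (fun i j hij => (inner_toLp _ _).trans (orthogonal hij))
    (fun i h => (sq_pos i).ne' (by rw [← inner_toLp, h, inner_zero_left])) total_toLp
    (toLp f) (toLp g)
  simp only [inner_toLp, mul_comm (f _) (p _ _)] at parseval
  exact parseval

theorem span_gegenbauer_topologicalClosure (hα : -1 / 2 ≤ α) :
    (Submodule.span ℝ (range fun n =>
      (gegenbauer α n).toContinuousMapOn (Icc (-1 : ℝ) 1))).topologicalClosure = ⊤ := by
  have span_eq : Submodule.span ℝ (range fun n =>
      (gegenbauer α n).toContinuousMapOn (Icc (-1 : ℝ) 1))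
      = Subalgebra.toSubmodule (polynomialFunctions (Icc (-1) 1)) := by
    rw [polynomialFunctions, Subalgebra.map_toSubmodule, Algebra.top_toSubmodule,
      ← (gegenbauerBasis α hα).span_eq, Submodule.map_span, ← range_comp]
    simp only [Function.comp_def, gegenbauerBasis_apply]
    rfl
  rw [span_eq]
  exact congrArg Subalgebra.toSubmodule (polynomialFunctions_closure_eq_top (-1) 1)

theorem hasSum_gegenbauer_parseval (hα : -1 / 2 ≤ α) {f g : Icc (-1 : ℝ) 1 → ℝ}
    (hf : Continuous f) (hg : Continuous g) :
    HasSum (fun k => (sqNorm α k)⁻¹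
        * (∫ t, (gegenbauer α k).eval t.1 * f t ∂gegenbauerMeasure α)
        * ∫ t, (gegenbauer α k).eval t.1 * g t ∂gegenbauerMeasure α)
      (∫ t, f t * g t ∂gegenbauerMeasure α) :=
  have := isFiniteMeasure_gegenbauerMeasure hα
  hasSum_integral_mul_integral_of_orthogonal
    (p := fun n => (gegenbauer α n).toContinuousMapOn (Icc (-1) 1))
    (fun _ _ => integral_gegenbauer_mul_of_ne hα) (sqNorm_pos hα)
    (span_gegenbauer_topologicalClosure hα) ⟨f, hf⟩ ⟨g, hg⟩

theorem gegenbauerBasis_repr (hα : -1 / 2 ≤ α) (Q : ℝ[X]) (k : ℕ) :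
    (gegenbauerBasis α hα).repr Q k = (sqNorm α k)⁻¹ *
      ∫ t : Icc (-1 : ℝ) 1, (gegenbauer α k).eval t.1 * Q.eval t.1 ∂gegenbauerMeasure α := by
  set c := (gegenbauerBasis α hα).repr Q
  have expansion : Q = ∑ i ∈ c.support, c i • gegenbauer α i := by
    conv_lhs => rw [← (gegenbauerBasis α hα).linearCombination_repr Q,
      Finsupp.linearCombination_apply, Finsupp.sum]
    simp only [gegenbauerBasis_apply, c]
  rw [eq_inv_mul_iff_mul_eq₀ (sqNorm_pos hα k).ne', expansion]
  simp only [eval_finsetSum, eval_smul, smul_eq_mul, Finset.mul_sum]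
  rw [integral_finsetSum _ fun i _ => integrable_gegenbauerMeasure hα (by fun_prop),
    Finset.sum_eq_single k]
  · simp_rw [mul_left_comm _ (c k), integral_const_mul]
    exact mul_comm _ _
  · intro i _ hik
    simp_rw [mul_left_comm _ (c i), integral_const_mul]
    rw [integral_gegenbauer_mul_of_ne hα hik.symm, mul_zero]
  · intro hk
    simp [Finsupp.notMem_support_iff.1 hk]

theorem summable_toReal_pmf {ι : Type*} (μ : PMF ι) : Summable fun k => (μ k).toReal :=
  ENNReal.summable_toReal μ.tsum_coe_ne_top

theorem tsum_toReal_pmf {ι : Type*} (μ : PMF ι) : ∑' k, (μ k).toReal = 1 := by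
  rw [← ENNReal.tsum_toReal_eq fun k => μ.apply_ne_top k, μ.tsum_coe, ENNReal.toReal_one]

/-- The Gegenbauer transform `t ↦ ∑ₖ μ(k) P_k^{(α)}(t)` of a probability measure `μ` on `ℕ`. It is
multiplicative for the convolution of the polynomial hypergroup. -/
noncomputable def transform (α : ℝ) (μ : PMF ℕ) (t : ℝ) : ℝ :=
  ∑' k, (μ k).toReal * (gegenbauer α k).eval t

theorem norm_toReal_mul_gegenbauer_eval_le (hα : -1 / 2 ≤ α) (μ : PMF ℕ) (k : ℕ) {t : ℝ}
    (ht : |t| ≤ 1) : ‖(μ k).toReal * (gegenbauer α k).eval t‖ ≤ (μ k).toReal := by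
  rw [norm_mul, Real.norm_of_nonneg ENNReal.toReal_nonneg]
  exact mul_le_of_le_one_right ENNReal.toReal_nonneg (abs_gegenbauer_eval_le_one hα k ht)

theorem hasSum_transform (hα : -1 / 2 ≤ α) (μ : PMF ℕ) {t : ℝ} (ht : |t| ≤ 1) :
    HasSum (fun k => (μ k).toReal * (gegenbauer α k).eval t) (transform α μ t) :=
  ((summable_toReal_pmf μ).of_norm_bounded
    fun k => norm_toReal_mul_gegenbauer_eval_le hα μ k ht).hasSum

theorem continuousOn_transform (hα : -1 / 2 ≤ α) (μ : PMF ℕ) :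
    ContinuousOn (transform α μ) (Icc (-1) 1) :=
  continuousOn_tsum (fun k => (continuous_const.mul (gegenbauer α k).continuous).continuousOn)
    (summable_toReal_pmf μ) fun k _ ht =>
      norm_toReal_mul_gegenbauer_eval_le hα μ k (abs_le.2 ht)

theorem abs_transform_le_one (hα : -1 / 2 ≤ α) (μ : PMF ℕ) {t : ℝ} (ht : |t| ≤ 1) :
    |transform α μ t| ≤ 1 :=
  (tsum_of_norm_bounded (summable_toReal_pmf μ).hasSum
    fun k => norm_toReal_mul_gegenbauer_eval_le hα μ k ht).trans_eq (tsum_toReal_pmf μ)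

theorem transform_one (hα : -1 / 2 ≤ α) (μ : PMF ℕ) : transform α μ 1 = 1 := by
  have hα' : -1 < α := by linarith
  simp only [transform, gegenbauer_eval_one hα', mul_one, tsum_toReal_pmf]

theorem step_eq_tsum (hα : -1 / 2 ≤ α) (μ : PMF ℕ) (x y : ℕ) :
    step α hα μ x y = ∑' k, (μ k).toReal * linCoeff α hα x k y := by
  rw [step, conv, ← Function.Injective.tsum_eq (Prod.mk_right_injective x)]
  · simp
  · rintro ⟨a, k⟩ h
    refine ⟨k, ?_⟩
    by_contra hne
    have hax : a ≠ x := fun hax => hne (by rw [hax])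
    simp [hax] at h

theorem step_eq_integral (hα : -1 / 2 ≤ α) (μ : PMF ℕ) (x y : ℕ) :
    step α hα μ x y = (sqNorm α y)⁻¹ * ∫ t : Icc (-1 : ℝ) 1, (gegenbauer α x).eval t.1
      * (transform α μ t.1 * (gegenbauer α y).eval t.1) ∂gegenbauerMeasure α := by
  have hasSum_integral : HasSum
      (fun k => ∫ t : Icc (-1 : ℝ) 1, (μ k).toReal * (gegenbauer α k).eval t.1
        * ((gegenbauer α x).eval t.1 * (gegenbauer α y).eval t.1) ∂gegenbauerMeasure α)
      (∫ t : Icc (-1 : ℝ) 1, transform α μ t.1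
        * ((gegenbauer α x).eval t.1 * (gegenbauer α y).eval t.1) ∂gegenbauerMeasure α) := by
    refine hasSum_integral_of_dominated_convergence (fun k _ => (μ k).toReal)
      (fun k => Continuous.aestronglyMeasurable (by fun_prop))
      (fun k => ae_of_all _ fun t => ?_) (ae_of_all _ fun _ => summable_toReal_pmf μ)
      (integrable_gegenbauerMeasure hα continuous_const)
      (ae_of_all _ fun t => (hasSum_transform hα μ (abs_le.2 t.2)).mul_right _)
    have abs_eval_le (n : ℕ) := abs_gegenbauer_eval_le_one hα n (abs_le.2 t.2)
    rw [norm_mul]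
    refine (mul_le_of_le_one_right (norm_nonneg _) ?_).trans
      (norm_toReal_mul_gegenbauer_eval_le hα μ k (abs_le.2 t.2))
    rw [norm_mul]
    exact mul_le_one₀ (abs_eval_le x) (norm_nonneg _) (abs_eval_le y)
  simp_rw [mul_left_comm _ (transform α μ _)]
  rw [step_eq_tsum, ← hasSum_integral.tsum_eq, ← tsum_mul_left]
  refine tsum_congr fun k => ?_
  rw [linCoeff, gegenbauerBasis_repr, mul_left_comm, ← integral_const_mul]
  simp only [eval_mul]
  congr 2 with t
  ring

theorem nStep_eq_integral (hα : -1 / 2 ≤ α) (μ : PMF ℕ) (n x y : ℕ) :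
    nStep α hα μ n x y = (sqNorm α y)⁻¹ * ∫ t : Icc (-1 : ℝ) 1, transform α μ t.1 ^ n
      * (gegenbauer α x).eval t.1 * (gegenbauer α y).eval t.1 ∂gegenbauerMeasure α := by
  induction n generalizing y with
  | zero =>
    simp only [nStep, pow_zero, one_mul]
    split_ifs with h
    · subst h
      exact (inv_mul_cancel₀ (sqNorm_pos hα x).ne').symm
    · rw [integral_gegenbauer_mul_of_ne hα h, mul_zero]
  | succ n ih =>
    have continuous_transform : Continuous fun t : Icc (-1 : ℝ) 1 => transform α μ t.1 :=
      (continuousOn_transform hα μ).domRestrict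
    have parseval := hasSum_gegenbauer_parseval hα
      (f := fun t => transform α μ t.1 ^ n * (gegenbauer α x).eval t.1)
      (g := fun t => transform α μ t.1 * (gegenbauer α y).eval t.1) (by fun_prop) (by fun_prop)
    have integrand (t : Icc (-1 : ℝ) 1) : transform α μ t.1 ^ (n + 1) * (gegenbauer α x).eval t.1
        * (gegenbauer α y).eval t.1 = transform α μ t.1 ^ n * (gegenbauer α x).eval t.1
          * (transform α μ t.1 * (gegenbauer α y).eval t.1) := by
      ring
    simp_rw [integrand]
    rw [nStep, ← parseval.tsum_eq, ← tsum_mul_left]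
    refine tsum_congr fun z => ?_
    rw [ih, step_eq_integral]
    simp only [mul_comm ((gegenbauer α z).eval _) (transform α μ _ ^ n * _)]
    ring

theorem gegenbauer_eval_eq_transform (hα : -1 / 2 ≤ α) (μ : PMF ℕ) {t : ℝ} (ht : |t| ≤ 1)
    (h : |transform α μ t| = 1) {k : ℕ} (hk : k ∈ μ.support) :
    (gegenbauer α k).eval t = transform α μ t := by
  set ε := transform α μ t with hε
  have sq_eps : ε * ε = 1 := by rw [← sq, ← sq_abs, h, one_pow]
  have hasSum_defect :
      HasSum (fun k => (μ k).toReal * (1 - ε * (gegenbauer α k).eval t)) 0 := by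
    have := (summable_toReal_pmf μ).hasSum.sub ((hasSum_transform hα μ ht).mul_left ε)
    rw [tsum_toReal_pmf, ← hε, sq_eps, sub_self] at this
    exact this.congr_fun fun k => by ring
  have defect_nonneg (k : ℕ) : 0 ≤ (μ k).toReal * (1 - ε * (gegenbauer α k).eval t) := by
    refine mul_nonneg ENNReal.toReal_nonneg (sub_nonneg.2 ((le_abs_self _).trans ?_))
    rw [abs_mul, h, one_mul]
    exact abs_gegenbauer_eval_le_one hα k ht
  have toReal_ne_zero : (μ k).toReal ≠ 0 :=
    ENNReal.toReal_ne_zero.2 ⟨(μ.mem_support_iff k).1 hk, μ.apply_ne_top k⟩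
  have defect_eq_zero := (mul_eq_zero.1 (congrFun
    ((hasSum_zero_iff_of_nonneg defect_nonneg).1 hasSum_defect) k)).resolve_left toReal_ne_zero
  linear_combination -ε * defect_eq_zero - (gegenbauer α k).eval t * sq_eps

theorem gegenbauer_neg_half (n : ℕ) : gegenbauer (-1 / 2) n = Chebyshev.T ℝ n := by
  induction n using Nat.twoStepInduction with
  | zero => simp [gegenbauer]
  | one => simp [gegenbauer]
  | more n ih ih_succ =>
    have C_inv_mul_C : C ((n + 1 : ℝ)⁻¹) * C (n + 1 : ℝ) = 1 := by
      rw [← C_mul, inv_mul_cancel₀ n.cast_add_one_ne_zero, C_1]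
    have denominator : (n : ℝ) + 2 * (-1 / 2) + 2 = n + 1 := by ring
    have numerator : C (2 * (n : ℝ) + 2 * (-1 / 2) + 3) = 2 * C (n + 1 : ℝ) := by
      rw [← C_ofNat, ← C_mul]
      ring_nf
    rw [gegenbauer, ih, ih_succ, denominator, numerator]
    push_cast
    rw [Chebyshev.T_add_two]
    linear_combination
      (2 * X * Chebyshev.T ℝ (n + 1) - Chebyshev.T ℝ n) * C_inv_mul_C

theorem sin_natCast_mul_eq_zero_iff (k : ℕ) (θ : ℝ) :
    Real.sin (k * θ) = 0 ↔ addOrderOf (θ : AddCircle π) ∣ k := by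
  rw [addOrderOf_dvd_iff_nsmul_eq_zero, ← AddCircle.coe_nsmul, AddCircle.coe_eq_zero_iff,
    Real.sin_eq_zero_iff]
  simp only [zsmul_eq_mul, nsmul_eq_mul]

theorem exists_mem_support_ne_zero {μ : PMF ℕ} (hμ : IsAperiodic α μ) :
    ∃ k ∈ μ.support, k ≠ 0 := by
  obtain ⟨k, hk, not_even⟩ := Set.not_subset.1 hμ.1
  refine ⟨k, hk, ?_⟩
  rintro rfl
  exact not_even Even.zero

theorem abs_eq_one_of_abs_gegenbauer_eval_eq_one (hα : -1 / 2 ≤ α) {μ : PMF ℕ}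
    (hμ : IsAperiodic α μ) {t : ℝ} (ht : |t| ≤ 1)
    (h : ∀ k ∈ μ.support, |(gegenbauer α k).eval t| = 1) : |t| = 1 := by
  obtain ⟨k, hk, k_ne_zero⟩ := exists_mem_support_ne_zero hμ
  rcases eq_or_lt_of_le hα with rfl | hα
  · obtain ⟨θ, rfl⟩ : ∃ θ, Real.cos θ = t :=
      ⟨Real.arccos t, Real.cos_arccos (abs_le.1 ht).1 (abs_le.1 ht).2⟩
    set d := addOrderOf (θ : AddCircle π) with hd
    have support_subset : μ.support ⊆ {k | d ∣ k} := fun k hk => by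
      have abs_cos := h k hk
      rw [gegenbauer_neg_half, Chebyshev.T_real_cos, Int.cast_natCast, abs_eq zero_le_one,
        ← Real.sin_eq_zero_iff_cos_eq] at abs_cos
      exact (sin_natCast_mul_eq_zero_iff k θ).1 abs_cos
    have : d < 2 := by
      by_contra! two_le
      exact hμ.2.2 rfl d two_le support_subset
    interval_cases d
    · exact absurd (zero_dvd_iff.1 (support_subset hk)) k_ne_zero
    · rw [abs_eq zero_le_one]
      refine Real.sin_eq_zero_iff_cos_eq.1 ?_
      simpa using (sin_natCast_mul_eq_zero_iff 1 θ).2 hd.symm.dvd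
  · by_contra ht_ne
    exact (abs_gegenbauer_eval_lt_one hα k_ne_zero (lt_of_le_of_ne ht ht_ne)).ne (h k hk)

theorem abs_transform_lt_one (hα : -1 / 2 ≤ α) {μ : PMF ℕ} (hμ : IsAperiodic α μ) {t : ℝ}
    (ht : t ∈ Ico (-1) 1) : |transform α μ t| < 1 := by
  have abs_t : |t| ≤ 1 := abs_le.2 ⟨ht.1, ht.2.le⟩
  refine lt_of_le_of_ne (abs_transform_le_one hα μ abs_t) fun abs_eq_one => ?_
  have eval_eq : ∀ k ∈ μ.support, (gegenbauer α k).eval t = transform α μ t :=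
    fun k => gegenbauer_eval_eq_transform hα μ abs_t abs_eq_one
  have t_eq_neg_one : t = -1 :=
    ((abs_eq zero_le_one).1 (abs_eq_one_of_abs_gegenbauer_eval_eq_one hα hμ abs_t
      fun k hk => eval_eq k hk ▸ abs_eq_one)).resolve_left ht.2.ne
  have hα' : -1 < α := by linarith
  simp only [t_eq_neg_one, gegenbauer_eval_neg, gegenbauer_eval_one hα', mul_one] at eval_eq
  rcases (abs_eq zero_le_one).1 abs_eq_one with h | h <;> rw [t_eq_neg_one] at h
  · exact hμ.1 fun k hk =>
      (neg_one_pow_eq_one_iff_even (by norm_num)).1 ((eval_eq k hk).trans h)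
  · exact hμ.2.1 fun k hk =>
      (neg_one_pow_eq_neg_one_iff_odd (by norm_num)).1 ((eval_eq k hk).trans h)

theorem summable_toReal_mul_eigenvalue (hα : -1 / 2 ≤ α) {μ : PMF ℕ}
    (hmom : Summable fun n : ℕ => (μ n).toReal * (n : ℝ) ^ 2) :
    Summable fun n => (μ n).toReal * eigenvalue α n := by
  refine (hmom.mul_left (2 * α + 2)).of_nonneg_of_le
    (fun n => mul_nonneg ENNReal.toReal_nonneg (eigenvalue_nonneg hα n)) fun n => ?_
  rw [mul_left_comm]
  refine mul_le_mul_of_nonneg_left ?_ ENNReal.toReal_nonneg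
  have le_sq : (n : ℝ) ≤ (n : ℝ) ^ 2 := mod_cast Nat.le_self_pow two_ne_zero n
  have : 0 ≤ 2 * α + 1 := by linarith
  rw [eigenvalue]
  nlinarith

theorem diffConst_pos (hα : -1 / 2 ≤ α) {μ : PMF ℕ} (hμ : ∃ k ∈ μ.support, k ≠ 0)
    (hmom : Summable fun n : ℕ => (μ n).toReal * (n : ℝ) ^ 2) : 0 < diffConst α μ := by
  obtain ⟨k, hk, k_ne_zero⟩ := hμ
  refine mul_pos (one_div_pos.2 (by linarith)) ?_
  exact (summable_toReal_mul_eigenvalue hα hmom).tsum_pos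
    (fun n => mul_nonneg ENNReal.toReal_nonneg (eigenvalue_nonneg hα n)) k
    (mul_pos (ENNReal.toReal_pos ((μ.mem_support_iff k).1 hk) (μ.apply_ne_top k))
      (eigenvalue_pos hα k_ne_zero))

theorem tendsto_one_sub_gegenbauer_eval_div (hα : -1 < α) (n : ℕ) :
    Tendsto (fun t => (1 - (gegenbauer α n).eval t) / (1 - t)) (𝓝[<] 1)
      (𝓝 (eigenvalue α n / (2 * (α + 1)))) := by
  have := hasDerivAt_iff_tendsto_slope.1 ((gegenbauer α n).hasDerivAt 1)
  rw [derivative_gegenbauer_eval_one hα] at this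
  refine (this.mono_left (nhdsWithin_mono _ fun t ht => ne_of_lt ht)).congr fun t => ?_
  rw [slope_comm, slope_def_field, gegenbauer_eval_one hα]

theorem tendsto_one_sub_transform_div (hα : -1 / 2 ≤ α) {μ : PMF ℕ}
    (hmom : Summable fun n : ℕ => (μ n).toReal * (n : ℝ) ^ 2) :
    Tendsto (fun t => (1 - transform α μ t) / (1 - t)) (𝓝[<] 1) (𝓝 (2 * diffConst α μ)) := by
  have hα' : -1 < α := by linarith
  have mem_Icc : ∀ᶠ t in 𝓝[<] (1 : ℝ), t ∈ Icc (-1) 1 := by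
    filter_upwards [Ico_mem_nhdsLT (show (-1 : ℝ) < 1 by norm_num)] with t ht
      using Ico_subset_Icc_self ht
  have tsum_eq : ∑' k, (μ k).toReal * (eigenvalue α k / (2 * (α + 1))) = 2 * diffConst α μ := by
    simp_rw [mul_div_assoc']
    rw [diffConst, tsum_div_const]
    simp only [eigenvalue]
    have : α + 1 ≠ 0 := by linarith
    field_simp
    ring
  have quotient_eq : ∀ᶠ t in 𝓝[<] (1 : ℝ),
      ∑' k, (μ k).toReal * ((1 - (gegenbauer α k).eval t) / (1 - t)) =
        (1 - transform α μ t) / (1 - t) := by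
    filter_upwards [mem_Icc] with t ht
    have := ((summable_toReal_pmf μ).hasSum.sub
      (hasSum_transform hα μ (abs_le.2 ht))).div_const (1 - t)
    rw [tsum_toReal_pmf] at this
    rw [← this.tsum_eq]
    exact tsum_congr fun k => by ring
  rw [← tsum_eq]
  refine Tendsto.congr' quotient_eq (tendsto_tsum_of_dominated_convergence
    (bound := fun k => (μ k).toReal * (eigenvalue α k / (2 * (α + 1)))) ?_
    (fun k => (tendsto_one_sub_gegenbauer_eval_div hα' k).const_mul _) ?_)
  · simp_rw [mul_div_assoc']
    exact (summable_toReal_mul_eigenvalue hα hmom).div_const _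
  · filter_upwards [mem_Icc, self_mem_nhdsWithin] with t ht ht1 k
    have one_sub_pos : 0 < 1 - t := sub_pos.2 ht1
    rw [norm_mul, norm_div, Real.norm_of_nonneg ENNReal.toReal_nonneg,
      Real.norm_of_nonneg one_sub_pos.le]
    refine mul_le_mul_of_nonneg_left ?_ ENNReal.toReal_nonneg
    rw [div_le_iff₀ one_sub_pos]
    exact abs_one_sub_gegenbauer_eval_le hα k ht

theorem exists_le_exp_neg_mul_of_tendsto {f : ℝ → ℝ} {a b L : ℝ} (hab : a < b)
    (hf : ContinuousOn f (Icc a b)) (hf_lt : ∀ t ∈ Ico a b, f t < 1) (hfb : f b ≤ 1) (hL : 0 < L)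
    (hlim : Tendsto (fun t => (1 - f t) / (b - t)) (𝓝[<] b) (𝓝 L)) :
    ∃ c > 0, ∀ t ∈ Icc a b, f t ≤ Real.exp (-(c * (b - t))) := by
  set g := Function.update (fun t => (1 - f t) / (b - t)) b L
  have g_of_lt {t : ℝ} (ht : t < b) : g t = (1 - f t) / (b - t) := Function.update_of_ne ht.ne _ _
  have continuousOn_g : ContinuousOn g (Icc a b) := by
    rw [continuousOn_update_iff, Icc_sdiff_right, nhdsWithin_Ico_eq_nhdsLT hab]
    refine ⟨?_, fun _ => hlim⟩
    exact (continuousOn_const.sub (hf.mono Ico_subset_Icc_self)).div (by fun_prop)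
      fun t ht => (sub_pos.2 ht.2).ne'
  obtain ⟨t₀, ht₀, isMinOn⟩ := isCompact_Icc.exists_isMinOn (nonempty_Icc.2 hab.le) continuousOn_g
  refine ⟨g t₀, ?_, fun t ht => ?_⟩
  · rcases ht₀.2.eq_or_lt with rfl | hlt
    · simpa [g] using hL
    · rw [g_of_lt hlt]
      exact div_pos (sub_pos.2 (hf_lt t₀ ⟨ht₀.1, hlt⟩)) (sub_pos.2 hlt)
  · rcases ht.2.eq_or_lt with rfl | hlt
    · simpa using hfb
    · have le_quotient : g t₀ ≤ (1 - f t) / (b - t) := g_of_lt hlt ▸ isMinOn ht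
      rw [le_div_iff₀ (sub_pos.2 hlt)] at le_quotient
      linarith [Real.add_one_le_exp (-(g t₀ * (b - t)))]

theorem exists_abs_transform_le_exp (hα : -1 / 2 ≤ α) {μ : PMF ℕ} (hμ : IsAperiodic α μ)
    (hmom : Summable fun n : ℕ => (μ n).toReal * (n : ℝ) ^ 2) :
    ∃ c > 0, ∀ t ∈ Icc (-1 : ℝ) 1, |transform α μ t| ≤ Real.exp (-(c * (1 - t))) := by
  have neg_one_lt_one : (-1 : ℝ) < 1 := by norm_num
  have transform_pos : ∀ᶠ t in 𝓝[<] (1 : ℝ), 0 < transform α μ t := by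
    rw [← nhdsWithin_Ico_eq_nhdsLT neg_one_lt_one]
    have := (continuousOn_transform hα μ 1 (right_mem_Icc.2 neg_one_lt_one.le)).mono
      Ico_subset_Icc_self
    exact this.eventually (lt_mem_nhds (by rw [transform_one hα]; exact one_pos))
  refine exists_le_exp_neg_mul_of_tendsto neg_one_lt_one (continuousOn_transform hα μ).abs
    (fun t ht => abs_transform_lt_one hα hμ ht) (abs_transform_le_one hα μ abs_one.le)
    (mul_pos two_pos (diffConst_pos hα (exists_mem_support_ne_zero hμ) hmom))
    ((tendsto_one_sub_transform_div hα hmom).congr' ?_)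
  filter_upwards [transform_pos] with t ht
  rw [abs_of_pos ht]

theorem tendsto_transform_pow (hα : -1 / 2 ≤ α) {μ : PMF ℕ}
    (hmom : Summable fun n : ℕ => (μ n).toReal * (n : ℝ) ^ 2) {t : ℕ → ℝ} {z : ℝ}
    (ht : Tendsto t atTop (𝓝[<] 1)) (hz : Tendsto (fun n => n * (1 - t n)) atTop (𝓝 z)) :
    Tendsto (fun n => transform α μ (t n) ^ n) atTop (𝓝 (Real.exp (-(2 * diffConst α μ * z)))) := by
  have := ((tendsto_one_sub_transform_div hα hmom).comp ht).mul hz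
  refine (Real.tendsto_one_add_pow_exp_of_tendsto
    (g := fun n => transform α μ (t n) - 1) (this.neg.congr' ?_)).congr fun n => ?_
  · filter_upwards [(tendsto_nhdsWithin_iff.1 ht).2] with n hn
    have : 1 - t n ≠ 0 := (sub_pos.2 hn).ne'
    simp only [Function.comp_apply]
    field_simp
    ring
  · rw [add_sub_cancel]

theorem ascPochhammer_eval_eq_prod (a : ℝ) (k : ℕ) :
    (ascPochhammer ℝ k).eval a = ∏ i ∈ Finset.range k, (a + i) := by
  induction k with
  | zero => simp
  | succ k ih => rw [ascPochhammer_succ_eval, ih, Finset.prod_range_succ]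

theorem ascPochhammer_eval_add (a : ℝ) (i j : ℕ) : (ascPochhammer ℝ (i + j)).eval a =
    (ascPochhammer ℝ i).eval a * (ascPochhammer ℝ j).eval (a + i) := by
  simp [← ascPochhammer_mul]

theorem min_one_le_ascPochhammer_eval {a : ℝ} (ha : 0 < a) (k : ℕ) :
    min a 1 ≤ (ascPochhammer ℝ k).eval a := by
  cases k with
  | zero => simp
  | succ k =>
    refine (min_le_left a 1).trans ?_
    rw [ascPochhammer_eval_eq_prod, Finset.prod_range_succ', Nat.cast_zero, add_zero]
    refine le_mul_of_one_le_left ha.le (Finset.one_le_prod fun i _ => ?_)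
    push_cast
    linarith [(i.cast_nonneg : (0 : ℝ) ≤ i)]

theorem Gamma_add_natCast {a : ℝ} (ha : 0 < a) (k : ℕ) :
    Real.Gamma (a + k) = Real.Gamma a * (ascPochhammer ℝ k).eval a := by
  induction k with
  | zero => simp
  | succ k ih =>
    rw [Nat.cast_succ, ← add_assoc, Real.Gamma_add_one (by positivity), ih, ascPochhammer_succ_eval]
    ring

/-- The confluent hypergeometric limit function `₀F₁(a; z) = ∑ₖ zᵏ / (k! (a)ₖ)`, a normalized
Bessel function. Meaningful only if `a` is not a nonpositive integer. -/
noncomputable def zeroFOne (a z : ℝ) : ℝ :=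
  ∑' k : ℕ, z ^ k / (k.factorial * (ascPochhammer ℝ k).eval a)

theorem summable_norm_zeroFOne {a : ℝ} (ha : 0 < a) (z : ℝ) :
    Summable fun k : ℕ => ‖z ^ k / (k.factorial * (ascPochhammer ℝ k).eval a)‖ := by
  refine ((Real.summable_pow_div_factorial |z|).div_const (min a 1)).of_nonneg_of_le
    (fun k => norm_nonneg _) fun k => ?_
  have : 0 < min a 1 := lt_min ha one_pos
  rw [norm_div, norm_pow, Real.norm_eq_abs, div_div, Real.norm_of_nonneg
    (mul_nonneg k.factorial.cast_nonneg (ascPochhammer_pos k a ha).le)]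
  gcongr
  exact min_one_le_ascPochhammer_eval ha k

theorem hasSum_zeroFOne {a : ℝ} (ha : 0 < a) (z : ℝ) :
    HasSum (fun k : ℕ => z ^ k / (k.factorial * (ascPochhammer ℝ k).eval a)) (zeroFOne a z) :=
  (summable_norm_zeroFOne ha z).of_norm.hasSum

theorem zeroFOne_zero_right (a : ℝ) : zeroFOne a 0 = 1 := by
  rw [zeroFOne, tsum_eq_single 0 fun k hk => by rw [zero_pow hk, zero_div]]
  simp

theorem zeroFOne_pos {a z : ℝ} (ha : 0 < a) (hz : 0 ≤ z) : 0 < zeroFOne a z :=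
  (hasSum_zeroFOne ha z).summable.tsum_pos
    (fun k => div_nonneg (pow_nonneg hz k)
      (mul_nonneg k.factorial.cast_nonneg (ascPochhammer_pos k a ha).le)) 0 (by simp)

theorem besselI_two_mul (hα : -1 < α) {w : ℝ} (hw : 0 < w) :
    besselI α (2 * w) = w ^ α / Real.Gamma (α + 1) * zeroFOne (α + 1) (w ^ 2) := by
  rw [besselI, zeroFOne, ← tsum_mul_left]
  refine tsum_congr fun k => ?_
  rw [mul_div_cancel_left₀ w two_ne_zero, add_assoc (k : ℝ), add_comm (k : ℝ) (α + 1),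
    Gamma_add_natCast (by linarith), Real.rpow_add hw, mul_comm (2 : ℝ), Real.rpow_mul hw.le,
    Real.rpow_natCast, Real.rpow_two, ← pow_mul, ← pow_mul, mul_comm k 2, div_mul_div_comm]
  ring

theorem norm_eigenvalue_sub_mul_div_le (hα : -1 / 2 ≤ α) {j n : ℕ} (hj : j ≤ n) (t : ℝ) :
    ‖(eigenvalue α n - eigenvalue α j) * (t - 1) / (2 * (α + 1 + j))‖
      ≤ |eigenvalue α n * (1 - t)| := by
  have denominator_ge : 1 ≤ 2 * (α + 1 + j) := by linarith [(j.cast_nonneg : (0 : ℝ) ≤ j)]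
  have difference_nonneg : 0 ≤ eigenvalue α n - eigenvalue α j :=
    sub_nonneg.2 (eigenvalue_mono hα hj)
  rw [norm_div, norm_mul, abs_mul, Real.norm_of_nonneg difference_nonneg,
    ← Real.norm_eq_abs (1 - t), norm_sub_rev,
    Real.norm_of_nonneg (zero_le_one.trans denominator_ge), abs_of_nonneg (eigenvalue_nonneg hα n)]
  refine (div_le_self (by positivity) denominator_ge).trans ?_
  gcongr
  exact sub_le_self _ (eigenvalue_nonneg hα j)

/-- Mehler–Heine asymptotics. The terms of the hypergeometric series of `P_N` at `t` converge, and
are bounded by `Kᵏ / k!` as soon as `λ_N (1 - t) ≤ K`. -/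
theorem tendsto_gegenbauer_eval (hα : -1 / 2 ≤ α) {ι : Type*} {l : Filter ι} {N : ι → ℕ}
    {t : ι → ℝ} {z : ℝ} (ht : Tendsto t l (𝓝 1))
    (hz : Tendsto (fun i => eigenvalue α (N i) * (1 - t i)) l (𝓝 z)) :
    Tendsto (fun i => (gegenbauer α (N i)).eval (t i)) l (𝓝 (zeroFOne (α + 1) (-z / 2))) := by
  have tendsto_factor (j : ℕ) :
      Tendsto (fun i => (eigenvalue α (N i) - eigenvalue α j) * (t i - 1) / (2 * (α + 1 + j))) l
        (𝓝 (-z / 2 / (α + 1 + j))) := by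
    have tendsto_sub_one : Tendsto (fun i => t i - 1) l (𝓝 0) := by
      simpa using ht.sub_const 1
    have := (hz.neg.sub (tendsto_sub_one.const_mul (eigenvalue α j))).div_const (2 * (α + 1 + j))
    rw [mul_zero, sub_zero, ← div_div] at this
    exact this.congr fun i => by ring
  simp_rw [gegenbauer_eval_eq_tsum (show -1 < α by linarith), zeroFOne,
    ascPochhammer_eval_eq_prod]
  refine tendsto_tsum_of_dominated_convergence (Real.summable_pow_div_factorial (|z| + 1))
    (fun k => ?_) ?_
  · rw [mul_comm, ← div_div, ← Finset.card_range k, ← Finset.prod_const, Finset.card_range,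
      ← Finset.prod_div_distrib]
    exact (tendsto_finsetProd _ fun j _ => tendsto_factor j).div_const _
  · filter_upwards [hz.abs.eventually (gt_mem_nhds (lt_add_one |z|))] with i hi k
    rw [norm_div, Real.norm_of_nonneg k.factorial.cast_nonneg]
    gcongr
    rcases lt_or_ge (N i) k with hlt | hle
    · rw [Finset.prod_eq_zero (Finset.mem_range.2 hlt) (by simp), norm_zero]
      positivity
    · rw [norm_prod, ← Finset.card_range k, ← Finset.prod_const, Finset.card_range]
      refine Finset.prod_le_prod (fun _ _ => norm_nonneg _) fun j hj => ?_
      exact (norm_eigenvalue_sub_mul_div_le hα ((Finset.mem_range.1 hj).le.trans hle) _).trans hi.le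

theorem ascPochhammer_eval_add_natCast_div (a : ℝ) (i j : ℕ) :
    (ascPochhammer ℝ j).eval (a + i) / j.factorial = ∑ p ∈ Finset.HasAntidiagonal.antidiagonal j,
      i.choose p.1 * ((ascPochhammer ℝ p.2).eval (a + p.1) / p.2.factorial) := by
  have eval_div_factorial (r : ℝ) (n : ℕ) :
      (ascPochhammer ℝ n).eval r / n.factorial = Ring.choose (r + n - 1) n := by
    rw [← ascPochhammer_smeval_eq_eval, ← Ring.factorial_nsmul_multichoose_eq_ascPochhammer,
      Ring.multichoose_eq, nsmul_eq_mul, mul_div_cancel_left₀ _ (by positivity)]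
  simp_rw [eval_div_factorial]
  rw [show a + i + j - 1 = i + (a + j - 1) by ring, Ring.add_choose_eq _ (Commute.all _ _)]
  refine Finset.sum_congr rfl fun p hp => ?_
  rw [Ring.choose_natCast, ← Finset.HasAntidiagonal.mem_antidiagonal.1 hp]
  push_cast
  ring_nf

theorem ascPochhammer_eval_add_div {a : ℝ} (ha : 0 < a) (i j : ℕ) :
    (ascPochhammer ℝ (i + j)).eval a / (i.factorial * (ascPochhammer ℝ i).eval a
        * (j.factorial * (ascPochhammer ℝ j).eval a)) =
      ∑ k ∈ Finset.range (min i j + 1), 1 / (k.factorial * (ascPochhammer ℝ k).eval a)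
        * (1 / (i - k).factorial * (1 / (j - k).factorial)) := by
  have eval_ne_zero (x : ℝ) (hx : 0 < x) (n : ℕ) : (ascPochhammer ℝ n).eval x ≠ 0 :=
    (ascPochhammer_pos n x hx).ne'
  have factorization : (ascPochhammer ℝ (i + j)).eval a / (i.factorial
      * (ascPochhammer ℝ i).eval a * (j.factorial * (ascPochhammer ℝ j).eval a)) =
        ((ascPochhammer ℝ j).eval (a + i) / j.factorial)
          / (i.factorial * (ascPochhammer ℝ j).eval a) := by
    rw [ascPochhammer_eval_add]
    have := eval_ne_zero a ha i
    field_simp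
  rw [factorization, ascPochhammer_eval_add_natCast_div,
    Finset.Nat.sum_antidiagonal_eq_sum_range_succ_mk, Finset.sum_div]
  symm
  refine Finset.sum_subset_zero_on_sdiff (Finset.range_subset_range.2 (by omega))
    (fun k hk => ?_) fun k hk => ?_
  · rw [Nat.choose_eq_zero_of_lt (by simp at hk; omega)]
    simp
  · obtain ⟨hki, hkj⟩ := le_min_iff.1 (Finset.mem_range_succ_iff.1 hk)
    have eval_split := ascPochhammer_eval_add a k (j - k)
    rw [Nat.add_sub_cancel' hkj] at eval_split
    rw [eval_split, Nat.cast_choose ℝ hki]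
    have := eval_ne_zero a ha k
    have := eval_ne_zero (a + k) (by positivity) (j - k)
    field_simp

theorem hasSum_sum_range_min {F : ℕ → ℕ → ℕ → ℝ} {S : ℝ}
    (h : HasSum (fun q : ℕ × ℕ × ℕ => F q.1 q.2.1 q.2.2) S) :
    HasSum (fun p : ℕ × ℕ => ∑ k ∈ Finset.range (min p.1 p.2 + 1), F k (p.1 - k) (p.2 - k)) S := by
  set e : ℕ × ℕ × ℕ → (ℕ × ℕ) × ℕ := fun q => ((q.1 + q.2.1, q.1 + q.2.2), q.1)
  set G : (ℕ × ℕ) × ℕ → ℝ := fun q =>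
    if q.2 ∈ Finset.range (min q.1.1 q.1.2 + 1) then F q.2 (q.1.1 - q.2) (q.1.2 - q.2) else 0
  have injective_e : Function.Injective e := by
    rintro ⟨k, p, q⟩ ⟨k', p', q'⟩ h
    simp only [e, Prod.mk.injEq] at h ⊢
    omega
  have hasSum_G : HasSum G S := by
    refine (injective_e.hasSum_iff ?_).1 (h.congr_fun fun q => ?_)
    · rintro ⟨⟨i, j⟩, k⟩ notMem_range
      refine if_neg fun hk => notMem_range ⟨(k, i - k, j - k), ?_⟩
      simp only [Finset.mem_range, e, Prod.mk.injEq, and_true] at hk ⊢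
      omega
    · simp [G, e]
  refine hasSum_G.prod_fiberwise fun p => ?_
  rw [← Finset.sum_congr rfl fun k hk => if_pos hk]
  exact hasSum_sum_of_ne_finset_zero fun k hk => if_neg hk

theorem hasSum_weber {a : ℝ} (ha : 0 < a) (z w : ℝ) :
    HasSum (fun p : ℕ × ℕ => z ^ p.1 * w ^ p.2 * ((ascPochhammer ℝ (p.1 + p.2)).eval a
        / (p.1.factorial * (ascPochhammer ℝ p.1).eval a
          * (p.2.factorial * (ascPochhammer ℝ p.2).eval a))))
      (Real.exp (z + w) * zeroFOne a (z * w)) := by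
  have hasSum_exp (x : ℝ) : HasSum (fun k : ℕ => x ^ k / k.factorial) (Real.exp x) := by
    rw [Real.exp_eq_exp_ℝ]
    exact NormedSpace.expSeries_div_hasSum_exp x
  have summable_exp_mul := summable_mul_of_summable_norm (hasSum_exp z).summable.norm
    (hasSum_exp w).summable.norm
  have hasSum_triple := (hasSum_zeroFOne ha (z * w)).mul
    ((hasSum_exp z).mul (hasSum_exp w) summable_exp_mul)
    (summable_mul_of_summable_norm (summable_norm_zeroFOne ha _) summable_exp_mul.norm)
  rw [← Real.exp_add, mul_comm (zeroFOne a _)] at hasSum_triple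
  refine (hasSum_sum_range_min (F := fun k p q => (z * w) ^ k
    / (k.factorial * (ascPochhammer ℝ k).eval a) * (z ^ p / p.factorial * (w ^ q / q.factorial)))
    hasSum_triple).congr_fun fun p => ?_
  rw [ascPochhammer_eval_add_div ha, Finset.mul_sum]
  refine Finset.sum_congr rfl fun k hk => ?_
  obtain ⟨hk₁, hk₂⟩ := le_min_iff.1 (Finset.mem_range_succ_iff.1 hk)
  rw [← pow_mul_pow_sub z hk₁, ← pow_mul_pow_sub w hk₂]
  ring

theorem integral_rpow_mul_exp_neg_mul_sq {a c : ℝ} (ha : 0 < a) (hc : 0 < c) (m : ℕ) :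
    ∫ s in Ioi (0 : ℝ), s ^ (2 * a - 1 + (2 * m : ℕ)) * Real.exp (-c * s ^ 2)
      = Real.Gamma a / (2 * c ^ a) * ((ascPochhammer ℝ m).eval a / c ^ m) := by
  have : (0 : ℝ) ≤ m := m.cast_nonneg
  have gaussian := integral_rpow_mul_exp_neg_mul_rpow (p := 2)
    (q := 2 * a - 1 + (2 * m : ℕ)) two_pos (by push_cast; linarith) hc
  have exponent : (2 * a - 1 + (2 * m : ℕ) + 1) / 2 = a + m := by
    push_cast
    ring
  rw [neg_div, exponent, Gamma_add_natCast ha, Real.rpow_neg hc.le, Real.rpow_add hc,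
    Real.rpow_natCast] at gaussian
  simp only [Real.rpow_two] at gaussian
  rw [gaussian]
  ring

/-- The coefficient of `s ^ (2 * (i + j))` in `₀F₁(a; z s²) ₀F₁(a; w s²)`, where `p = (i, j)`. -/
noncomputable def weberCoeff (a z w : ℝ) (p : ℕ × ℕ) : ℝ :=
  z ^ p.1 / (p.1.factorial * (ascPochhammer ℝ p.1).eval a)
    * (w ^ p.2 / (p.2.factorial * (ascPochhammer ℝ p.2).eval a))

theorem norm_weberCoeff {a : ℝ} (ha : 0 < a) (z w : ℝ) (p : ℕ × ℕ) :
    ‖weberCoeff a z w p‖ = weberCoeff a |z| |w| p := by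
  simp only [weberCoeff, norm_mul, norm_div, norm_pow, Real.norm_eq_abs, Nat.abs_cast,
    abs_of_pos (ascPochhammer_pos _ a ha)]

theorem zeroFOne_mul_zeroFOne_eq_tsum {a : ℝ} (ha : 0 < a) (z w s : ℝ) :
    zeroFOne a (z * s ^ 2) * zeroFOne a (w * s ^ 2)
      = ∑' p : ℕ × ℕ, weberCoeff a z w p * s ^ (2 * (p.1 + p.2)) := by
  rw [zeroFOne, zeroFOne, tsum_mul_tsum_of_summable_norm (summable_norm_zeroFOne ha _)
    (summable_norm_zeroFOne ha _)]
  refine tsum_congr fun p => ?_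
  rw [weberCoeff]
  ring

theorem hasSum_weberCoeff_mul_integral {a c : ℝ} (ha : 0 < a) (hc : 0 < c) (z w : ℝ) :
    HasSum (fun p : ℕ × ℕ => weberCoeff a z w p
        * ∫ s in Ioi (0 : ℝ), s ^ (2 * a - 1 + (2 * (p.1 + p.2) : ℕ)) * Real.exp (-c * s ^ 2))
      (Real.Gamma a / (2 * c ^ a)
        * (Real.exp ((z + w) / c) * zeroFOne a (z * w / c ^ 2))) := by
  have double_series := (hasSum_weber ha (z / c) (w / c)).mul_left (Real.Gamma a / (2 * c ^ a))
  rw [← add_div, div_mul_div_comm, ← sq] at double_series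
  refine double_series.congr_fun fun p => ?_
  rw [integral_rpow_mul_exp_neg_mul_sq ha hc, weberCoeff, pow_add]
  simp only [div_pow]
  ring

theorem integral_weber {a c : ℝ} (ha : 0 < a) (hc : 0 < c) (z w : ℝ) :
    ∫ s in Ioi (0 : ℝ), s ^ (2 * a - 1) * Real.exp (-c * s ^ 2)
        * (zeroFOne a (z * s ^ 2) * zeroFOne a (w * s ^ 2))
      = Real.Gamma a / (2 * c ^ a) * (Real.exp ((z + w) / c) * zeroFOne a (z * w / c ^ 2)) := by
  set E : ℕ × ℕ → ℝ → ℝ :=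
    fun p s => s ^ (2 * a - 1 + (2 * (p.1 + p.2) : ℕ)) * Real.exp (-c * s ^ 2) with hE
  have integrable_E (p : ℕ × ℕ) : IntegrableOn (E p) (Ioi 0) :=
    integrableOn_rpow_mul_exp_neg_mul_sq hc
      (by linarith [((2 * (p.1 + p.2) : ℕ).cast_nonneg : (0 : ℝ) ≤ _)])
  have integral_norm (p : ℕ × ℕ) : ∫ s in Ioi (0 : ℝ), ‖weberCoeff a z w p * E p s‖
      = weberCoeff a |z| |w| p * ∫ s in Ioi (0 : ℝ), E p s := by
    rw [← integral_const_mul]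
    refine setIntegral_congr_fun measurableSet_Ioi fun s hs => ?_
    have E_nonneg : 0 ≤ E p s := mul_nonneg (Real.rpow_nonneg (le_of_lt hs) _) (Real.exp_pos _).le
    simp only [norm_mul, norm_weberCoeff ha, Real.norm_of_nonneg E_nonneg]
  have hasSum_integral := hasSum_integral_of_summable_integral_norm
    (fun p => (integrable_E p).const_mul (weberCoeff a z w p))
    (by simpa only [integral_norm] using (hasSum_weberCoeff_mul_integral ha hc |z| |w|).summable)
  simp only [integral_const_mul] at hasSum_integral
  rw [← hasSum_integral.unique (hasSum_weberCoeff_mul_integral ha hc z w)]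
  refine setIntegral_congr_fun measurableSet_Ioi fun s hs => ?_
  simp only [zeroFOne_mul_zeroFOne_eq_tsum ha, hE, Real.rpow_add hs, Real.rpow_natCast]
  rw [← tsum_mul_left]
  exact tsum_congr fun p => by ring

theorem tendsto_mul_sin_div (s : ℝ) :
    Tendsto (fun r : ℝ => r * Real.sin (s / r)) atTop (𝓝 s) := by
  have sinc_limit : Tendsto (fun r : ℝ => s * Real.sinc (s / r)) atTop (𝓝 s) := by
    simpa using ((Real.continuous_sinc.tendsto 0).comp
      (tendsto_const_nhds.div_atTop tendsto_id)).const_mul s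
  refine sinc_limit.congr' ?_
  filter_upwards [eventually_ne_atTop 0] with r hr
  rcases eq_or_ne s 0 with rfl | hs
  · simp
  · rw [Real.sinc_of_ne_zero (div_ne_zero hs hr)]
    field_simp

theorem tendsto_sq_mul_one_sub_cos_div (s : ℝ) :
    Tendsto (fun r : ℝ => r ^ 2 * (1 - Real.cos (s / r))) atTop (𝓝 (s ^ 2 / 2)) := by
  have half_angle (r : ℝ) :
      2 * (r * Real.sin (s / 2 / r)) ^ 2 = r ^ 2 * (1 - Real.cos (s / r)) := by
    rw [mul_pow, Real.sin_sq_eq_half_sub, div_right_comm, mul_div_cancel₀ _ two_ne_zero]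
    ring
  convert ((tendsto_mul_sin_div (s / 2)).pow 2).const_mul 2 using 2
  · exact (half_angle _).symm
  · ring

theorem tendsto_cos_div_nhdsLT {s : ℝ} (hs : 0 < s) :
    Tendsto (fun r : ℝ => Real.cos (s / r)) atTop (𝓝[<] 1) := by
  have angle_limit : Tendsto (fun r : ℝ => s / r) atTop (𝓝 0) :=
    tendsto_const_nhds.div_atTop tendsto_id
  refine tendsto_nhdsWithin_iff.2 ⟨?_, ?_⟩
  · simpa [Function.comp_def] using (Real.continuous_cos.tendsto 0).comp angle_limit
  · filter_upwards [eventually_gt_atTop 0, angle_limit.eventually_lt_const Real.pi_pos]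
      with r hr hπ
    rw [mem_Iio, ← Real.cos_zero]
    exact Real.cos_lt_cos_of_nonneg_of_le_pi le_rfl hπ.le (div_pos hs hr)

theorem tendsto_sqrt_natCast_atTop : Tendsto (fun n : ℕ => √(n : ℝ)) atTop atTop :=
  Real.tendsto_sqrt_atTop.comp tendsto_natCast_atTop_atTop

theorem tendsto_natCast_mul_one_sub_cos (s : ℝ) :
    Tendsto (fun n : ℕ => n * (1 - Real.cos (s / √(n : ℝ)))) atTop (𝓝 (s ^ 2 / 2)) :=
  ((tendsto_sq_mul_one_sub_cos_div s).comp tendsto_sqrt_natCast_atTop).congr fun n => by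
    rw [Function.comp_apply, Real.sq_sqrt n.cast_nonneg]

theorem tendsto_eigenvalue_div {N : ℕ → ℕ} {v : ℝ} (α : ℝ)
    (hN : Tendsto (fun n : ℕ => (N n : ℝ) / √(n : ℝ)) atTop (𝓝 v)) :
    Tendsto (fun n : ℕ => eigenvalue α (N n) / n) atTop (𝓝 (v ^ 2)) := by
  have small : Tendsto (fun n : ℕ => (2 * α + 1) / √(n : ℝ)) atTop (𝓝 0) :=
    tendsto_const_nhds.div_atTop tendsto_sqrt_natCast_atTop
  have product_limit := hN.mul (hN.add small)
  rw [add_zero, ← sq] at product_limit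
  refine product_limit.congr fun n => ?_
  rw [← add_div, div_mul_div_comm, Real.mul_self_sqrt n.cast_nonneg, eigenvalue, add_assoc]

theorem tendsto_gegenbauer_eval_cos_div_sqrt (hα : -1 / 2 ≤ α) {N : ℕ → ℕ} {v s : ℝ} (hs : 0 < s)
    (hN : Tendsto (fun n : ℕ => (N n : ℝ) / √(n : ℝ)) atTop (𝓝 v)) :
    Tendsto (fun n : ℕ => (gegenbauer α (N n)).eval (Real.cos (s / √(n : ℝ)))) atTop
      (𝓝 (zeroFOne (α + 1) (-(v ^ 2 / 4) * s ^ 2))) := by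
  have cos_limit := ((tendsto_cos_div_nhdsLT hs).mono_right nhdsWithin_le_nhds).comp
    tendsto_sqrt_natCast_atTop
  have scale_limit := (tendsto_eigenvalue_div α hN).mul (tendsto_natCast_mul_one_sub_cos s)
  have argument : -(v ^ 2 / 4) * s ^ 2 = -(v ^ 2 * (s ^ 2 / 2)) / 2 := by ring
  rw [argument]
  refine tendsto_gegenbauer_eval hα cos_limit (scale_limit.congr' ?_)
  filter_upwards [eventually_ne_atTop 0] with n hn
  rw [← mul_assoc, div_mul_cancel₀ _ (Nat.cast_ne_zero.2 hn)]

/-- The integrand of the spectral representation `nStep_eq_integral` in the variable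
`s = √n arccos t`, with the powers of `√n` from the weight absorbed in the last factor. -/
noncomputable def rescaledIntegrand (α : ℝ) (μ : PMF ℕ) (n x y : ℕ) : ℝ → ℝ :=
  (Ioc 0 (π * √(n : ℝ))).indicator fun s =>
    transform α μ (Real.cos (s / √(n : ℝ))) ^ n * (gegenbauer α x).eval (Real.cos (s / √(n : ℝ)))
      * (gegenbauer α y).eval (Real.cos (s / √(n : ℝ)))
      * (√(n : ℝ) * Real.sin (s / √(n : ℝ))) ^ (2 * α + 1)

theorem integral_rescaledIntegrand (α : ℝ) (μ : PMF ℕ) {n : ℕ} (hn : n ≠ 0) (x y : ℕ) :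
    ∫ s in Ioi 0, rescaledIntegrand α μ n x y s = √(n : ℝ) * √(n : ℝ) ^ (2 * α + 1)
      * ∫ t : Icc (-1 : ℝ) 1, transform α μ t.1 ^ n * (gegenbauer α x).eval t.1
        * (gegenbauer α y).eval t.1 ∂gegenbauerMeasure α := by
  have hr : 0 < √(n : ℝ) := Real.sqrt_pos.2 (Nat.cast_pos.2 (Nat.pos_of_ne_zero hn))
  set F : ℝ → ℝ := fun t => transform α μ t ^ n * (gegenbauer α x).eval t * (gegenbauer α y).eval t
  have substitution := intervalIntegral.integral_comp_div (a := 0) (b := π * √(n : ℝ))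
    (fun θ => F (Real.cos θ) * (√(n : ℝ) * Real.sin θ) ^ (2 * α + 1)) hr.ne'
  rw [zero_div, mul_div_cancel_right₀ _ hr.ne'] at substitution
  rw [rescaledIntegrand, setIntegral_indicator measurableSet_Ioc,
    inter_eq_self_of_subset_right Ioc_subset_Ioi_self,
    ← intervalIntegral.integral_of_le (by positivity), substitution, smul_eq_mul, mul_assoc,
    integral_gegenbauerMeasure α F, ← intervalIntegral.integral_const_mul (_ ^ _)]
  congr 1
  refine intervalIntegral.integral_congr fun θ hθ => ?_
  rw [uIcc_of_le Real.pi_pos.le] at hθ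
  simp only [Real.mul_rpow hr.le (Real.sin_nonneg_of_nonneg_of_le_pi hθ.1 hθ.2)]
  ring

theorem sqrt_mul_nStep_eq (hα : -1 / 2 ≤ α) (μ : PMF ℕ) {n y : ℕ} (hn : n ≠ 0) (hy : y ≠ 0)
    (x : ℕ) :
    √(n : ℝ) * nStep α hα μ n x y = (sqNorm α y)⁻¹ / (y : ℝ) ^ (2 * α + 1)
      * ((y : ℝ) / √(n : ℝ)) ^ (2 * α + 1) * ∫ s in Ioi 0, rescaledIntegrand α μ n x y s := by
  have hn' : 0 < √(n : ℝ) := Real.sqrt_pos.2 (Nat.cast_pos.2 (Nat.pos_of_ne_zero hn))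
  have hy' : (0 : ℝ) < y := Nat.cast_pos.2 (Nat.pos_of_ne_zero hy)
  have : 0 < √(n : ℝ) ^ (2 * α + 1) := by positivity
  have : 0 < (y : ℝ) ^ (2 * α + 1) := by positivity
  rw [nStep_eq_integral, integral_rescaledIntegrand α μ hn, Real.div_rpow hy'.le hn'.le]
  field_simp

theorem measurable_rescaledIntegrand (hα : -1 / 2 ≤ α) (μ : PMF ℕ) (n x y : ℕ) :
    Measurable (rescaledIntegrand α μ n x y) := by
  have continuous_transform_cos : Continuous fun s => transform α μ (Real.cos (s / √(n : ℝ))) :=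
    (continuousOn_transform hα μ).comp_continuous (by fun_prop) fun s =>
      Real.cos_mem_Icc (s / √(n : ℝ))
  have continuous_weight :
      Continuous fun s : ℝ => (√(n : ℝ) * Real.sin (s / √(n : ℝ))) ^ (2 * α + 1) :=
    Continuous.rpow_const (by fun_prop) fun _ => Or.inr (by linarith)
  exact (Continuous.measurable (by fun_prop)).indicator measurableSet_Ioc

theorem tendsto_rescaledIntegrand (hα : -1 / 2 ≤ α) {μ : PMF ℕ}
    (hmom : Summable fun n : ℕ => (μ n).toReal * (n : ℝ) ^ 2) {M N : ℕ → ℕ} {u v s : ℝ}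
    (hM : Tendsto (fun n : ℕ => (M n : ℝ) / √(n : ℝ)) atTop (𝓝 u))
    (hN : Tendsto (fun n : ℕ => (N n : ℝ) / √(n : ℝ)) atTop (𝓝 v)) (hs : 0 < s) :
    Tendsto (fun n => rescaledIntegrand α μ n (M n) (N n) s) atTop
      (𝓝 (Real.exp (-diffConst α μ * s ^ 2) * zeroFOne (α + 1) (-(u ^ 2 / 4) * s ^ 2)
        * zeroFOne (α + 1) (-(v ^ 2 / 4) * s ^ 2) * s ^ (2 * α + 1))) := by
  have exponent : 2 * diffConst α μ * (s ^ 2 / 2) = diffConst α μ * s ^ 2 := by ring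
  have transform_limit := tendsto_transform_pow hα hmom
    ((tendsto_cos_div_nhdsLT hs).comp tendsto_sqrt_natCast_atTop)
    (tendsto_natCast_mul_one_sub_cos s)
  have weight_limit := ((tendsto_mul_sin_div s).comp tendsto_sqrt_natCast_atTop).rpow_const
    (p := 2 * α + 1) (Or.inl hs.ne')
  rw [exponent, ← neg_mul] at transform_limit
  refine (((transform_limit.mul (tendsto_gegenbauer_eval_cos_div_sqrt hα hs hM)).mul
    (tendsto_gegenbauer_eval_cos_div_sqrt hα hs hN)).mul weight_limit).congr' ?_
  filter_upwards [tendsto_sqrt_natCast_atTop.eventually_ge_atTop (s / π)] with n hn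
  have hmem : s ∈ Ioc 0 (π * √(n : ℝ)) := ⟨hs, (div_le_iff₀' Real.pi_pos).1 hn⟩
  rw [rescaledIntegrand, indicator_of_mem hmem]
  rfl

theorem abs_transform_cos_pow_le {μ : PMF ℕ} {c : ℝ} (hc : 0 < c)
    (decay : ∀ t ∈ Icc (-1 : ℝ) 1, |transform α μ t| ≤ Real.exp (-(c * (1 - t)))) {n : ℕ}
    (hn : n ≠ 0) {s : ℝ} (hs : |s / √(n : ℝ)| ≤ π) :
    |transform α μ (Real.cos (s / √(n : ℝ))) ^ n| ≤ Real.exp (-(2 * c / π ^ 2) * s ^ 2) := by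
  have cos_bound := Real.cos_le_one_sub_mul_cos_sq hs
  rw [div_pow, Real.sq_sqrt n.cast_nonneg] at cos_bound
  rw [abs_pow]
  refine (pow_le_pow_left₀ (abs_nonneg _) (decay _ (Real.cos_mem_Icc _)) n).trans ?_
  rw [← Real.exp_nat_mul, Real.exp_le_exp]
  have : (n : ℝ) ≠ 0 := Nat.cast_ne_zero.2 hn
  calc n * -(c * (1 - Real.cos (s / √(n : ℝ))))
      ≤ n * -(c * (2 / π ^ 2 * (s ^ 2 / n))) := by gcongr; linarith
    _ = -(2 * c / π ^ 2) * s ^ 2 := by field_simp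

theorem abs_rescaledIntegrand_le (hα : -1 / 2 ≤ α) {μ : PMF ℕ} {c : ℝ} (hc : 0 < c)
    (decay : ∀ t ∈ Icc (-1 : ℝ) 1, |transform α μ t| ≤ Real.exp (-(c * (1 - t)))) {n : ℕ}
    (hn : n ≠ 0) (x y : ℕ) {s : ℝ} (hs : 0 < s) :
    |rescaledIntegrand α μ n x y s|
      ≤ s ^ (2 * α + 1) * Real.exp (-(2 * c / π ^ 2) * s ^ 2) := by
  by_cases hmem : s ∈ Ioc 0 (π * √(n : ℝ))
  · have hr : 0 < √(n : ℝ) := Real.sqrt_pos.2 (Nat.cast_pos.2 (Nat.pos_of_ne_zero hn))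
    have hθ : 0 < s / √(n : ℝ) := div_pos hs hr
    have hθπ : s / √(n : ℝ) ≤ π := (div_le_iff₀ hr).2 hmem.2
    have abs_eval_le_one (k : ℕ) : |(gegenbauer α k).eval (Real.cos (s / √(n : ℝ)))| ≤ 1 :=
      abs_gegenbauer_eval_le_one hα k (Real.abs_cos_le_one _)
    have transform_le := abs_transform_cos_pow_le hc decay hn (abs_le.2 ⟨by linarith, hθπ⟩)
    have weight_nonneg : 0 ≤ √(n : ℝ) * Real.sin (s / √(n : ℝ)) :=
      mul_nonneg hr.le (Real.sin_nonneg_of_nonneg_of_le_pi hθ.le hθπ)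
    have weight_le : √(n : ℝ) * Real.sin (s / √(n : ℝ)) ≤ s :=
      (le_div_iff₀' hr).1 (Real.sin_le hθ.le)
    rw [rescaledIntegrand, indicator_of_mem hmem, abs_mul, abs_mul, abs_mul,
      abs_of_nonneg (Real.rpow_nonneg weight_nonneg _), mul_comm (s ^ _)]
    refine mul_le_mul ?_ (Real.rpow_le_rpow weight_nonneg weight_le (by linarith))
      (Real.rpow_nonneg weight_nonneg _) (Real.exp_pos _).le
    exact (mul_le_of_le_one_right (by positivity) (abs_eval_le_one y)).trans
      ((mul_le_of_le_one_right (abs_nonneg _) (abs_eval_le_one x)).trans transform_le)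
  · rw [rescaledIntegrand, indicator_of_notMem hmem, abs_zero]
    positivity

theorem tendsto_integral_rescaledIntegrand (hα : -1 / 2 ≤ α) {μ : PMF ℕ}
    (hμ : IsAperiodic α μ) (hmom : Summable fun n : ℕ => (μ n).toReal * (n : ℝ) ^ 2)
    {M N : ℕ → ℕ} {u v : ℝ} (hM : Tendsto (fun n : ℕ => (M n : ℝ) / √(n : ℝ)) atTop (𝓝 u))
    (hN : Tendsto (fun n : ℕ => (N n : ℝ) / √(n : ℝ)) atTop (𝓝 v)) :
    Tendsto (fun n => ∫ s in Ioi 0, rescaledIntegrand α μ n (M n) (N n) s) atTop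
      (𝓝 (Real.Gamma (α + 1) / (2 * diffConst α μ ^ (α + 1))
        * (Real.exp (-(u ^ 2 + v ^ 2) / (4 * diffConst α μ))
          * zeroFOne (α + 1) ((u * v / (4 * diffConst α μ)) ^ 2)))) := by
  obtain ⟨c, hc, decay⟩ := exists_abs_transform_le_exp hα hμ hmom
  have hC := diffConst_pos hα (exists_mem_support_ne_zero hμ) hmom
  have weber := integral_weber (by linarith : 0 < α + 1) hC (-(u ^ 2 / 4)) (-(v ^ 2 / 4))
  have exponent : 2 * (α + 1) - 1 = 2 * α + 1 := by ring
  have exp_arg : (-(u ^ 2 / 4) + -(v ^ 2 / 4)) / diffConst α μ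
      = -(u ^ 2 + v ^ 2) / (4 * diffConst α μ) := by
    ring
  have bessel_arg : -(u ^ 2 / 4) * -(v ^ 2 / 4) / diffConst α μ ^ 2
      = (u * v / (4 * diffConst α μ)) ^ 2 := by
    ring
  rw [exponent, exp_arg, bessel_arg] at weber
  rw [← weber]
  refine tendsto_integral_filter_of_dominated_convergence
    (fun s => s ^ (2 * α + 1) * Real.exp (-(2 * c / π ^ 2) * s ^ 2))
    (.of_forall fun n => (measurable_rescaledIntegrand hα μ n _ _).aestronglyMeasurable)
    ?_ (integrableOn_rpow_mul_exp_neg_mul_sq (by positivity) (by linarith)) ?_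
  · filter_upwards [eventually_ne_atTop 0] with n hn
    exact ae_restrict_of_forall_mem measurableSet_Ioi fun s hs =>
      abs_rescaledIntegrand_le hα hc decay hn _ _ hs
  · refine ae_restrict_of_forall_mem measurableSet_Ioi fun s hs => ?_
    convert tendsto_rescaledIntegrand hα hmom hM hN hs using 2
    ring

/-- The scaling limit at `(u, v)` of the transition probabilities of a walk with diffusion
constant `C`: the transition density from `u` to `v`, at time `2 C`, of the Bessel process of
dimension `2 α + 2`. It is written with `zeroFOne` instead of `besselI` so that it makes sense at
`u = 0`. -/
noncomputable def limitDensity (α C u v : ℝ) : ℝ :=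
  v ^ (2 * α + 1) / (2 ^ (2 * α + 1) * C ^ (α + 1) * Real.Gamma (α + 1))
    * Real.exp (-(u ^ 2 + v ^ 2) / (4 * C)) * zeroFOne (α + 1) ((u * v / (4 * C)) ^ 2)

theorem limitDensity_pos (hα : -1 < α) {C v : ℝ} (hC : 0 < C) (hv : 0 < v) (u : ℝ) :
    0 < limitDensity α C u v := by
  have hα' : 0 < α + 1 := by linarith
  have := Real.Gamma_pos_of_pos hα'
  have := zeroFOne_pos hα' (sq_nonneg (u * v / (4 * C)))
  rw [limitDensity]
  positivity

theorem limitDensity_zero_left (α C v : ℝ) :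
    limitDensity α C 0 v = v ^ (2 * α + 1) * Real.exp (-(v ^ 2 / (4 * C)))
      / (2 ^ (2 * α + 1) * C ^ (α + 1) * Real.Gamma (α + 1)) := by
  rw [limitDensity, zero_mul, zero_div, zero_pow two_ne_zero, zeroFOne_zero_right, mul_one,
    zero_add, neg_div, div_mul_eq_mul_div]

theorem limitDensity_self (hα : -1 < α) {C x : ℝ} (hC : 0 < C) (hx : 0 < x) :
    limitDensity α C x x
      = x / (2 * C) * Real.exp (-(x ^ 2 / (2 * C))) * besselI α (x ^ 2 / (2 * C)) := by
  have double_half : x ^ 2 / (2 * C) = 2 * (x ^ 2 / (4 * C)) := by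
    field_simp
    norm_num
  have exp_arg : -(x ^ 2 + x ^ 2) / (4 * C) = -(2 * (x ^ 2 / (4 * C))) := by ring
  have hG : 0 < Real.Gamma (α + 1) := Real.Gamma_pos_of_pos (by linarith)
  have power : (x ^ 2 / (4 * C)) ^ α = x ^ (2 * α) / (2 ^ (2 * α) * C ^ α) := by
    rw [Real.div_rpow (by positivity) (by positivity), Real.mul_rpow (by norm_num) hC.le,
      ← Real.rpow_two, ← Real.rpow_mul hx.le, Real.rpow_mul zero_le_two, Real.rpow_two]
    norm_num
  rw [limitDensity, double_half, exp_arg, besselI_two_mul hα (by positivity), power, ← sq x,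
    Real.rpow_add_one hx.ne', Real.rpow_add_one two_ne_zero, Real.rpow_add_one hC.ne']
  field_simp

theorem tendsto_sqrt_mul_nStep (hα : -1 / 2 ≤ α) {μ : PMF ℕ} (hμ : IsAperiodic α μ)
    (hmom : Summable fun n : ℕ => (μ n).toReal * (n : ℝ) ^ 2) {M N : ℕ → ℕ} {u v : ℝ}
    (hv : 0 < v) (hM : Tendsto (fun n : ℕ => (M n : ℝ) / √(n : ℝ)) atTop (𝓝 u))
    (hN : Tendsto (fun n : ℕ => (N n : ℝ) / √(n : ℝ)) atTop (𝓝 v)) :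
    Tendsto (fun n : ℕ => √(n : ℝ) * nStep α hα μ n (M n) (N n)) atTop
      (𝓝 (limitDensity α (diffConst α μ) u v)) := by
  have tendsto_N : Tendsto N atTop atTop := by
    refine tendsto_natCast_atTop_iff.1
      ((hN.pos_mul_atTop hv tendsto_sqrt_natCast_atTop).congr' ?_)
    filter_upwards [tendsto_sqrt_natCast_atTop.eventually_ne_atTop 0] with n hn
    exact div_mul_cancel₀ _ hn
  have hC := diffConst_pos hα (exists_mem_support_ne_zero hμ) hmom
  have hG : 0 < Real.Gamma (α + 1) := Real.Gamma_pos_of_pos (by linarith)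
  have limit_eq : 2 / (2 ^ (2 * α + 1) * Real.Gamma (α + 1) ^ 2) * v ^ (2 * α + 1)
      * (Real.Gamma (α + 1) / (2 * diffConst α μ ^ (α + 1))
        * (Real.exp (-(u ^ 2 + v ^ 2) / (4 * diffConst α μ))
          * zeroFOne (α + 1) ((u * v / (4 * diffConst α μ)) ^ 2)))
      = limitDensity α (diffConst α μ) u v := by
    rw [limitDensity]
    field_simp
  rw [← limit_eq]
  refine ((((tendsto_inv_sqNorm_div_rpow hα).comp tendsto_N).mul
    (hN.rpow_const (Or.inl hv.ne'))).mul
      (tendsto_integral_rescaledIntegrand hα hμ hmom hM hN)).congr' ?_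
  filter_upwards [eventually_ne_atTop 0, tendsto_N.eventually_ne_atTop 0] with n hn hNn
  exact (sqrt_mul_nStep_eq hα μ hn hNn (M n)).symm

theorem tendsto_floor_mul_sqrt_div {x : ℝ} (hx : 0 ≤ x) :
    Tendsto (fun n : ℕ => (⌊x * √(n : ℝ)⌋₊ : ℝ) / √(n : ℝ)) atTop (𝓝 x) :=
  (tendsto_nat_floor_mul_div_atTop hx).comp tendsto_sqrt_natCast_atTop

theorem isEquivalent_sqrt_mul_nStep (hα : -1 / 2 ≤ α) {μ : PMF ℕ} (hμ : IsAperiodic α μ)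
    (hmom : Summable fun n : ℕ => (μ n).toReal * (n : ℝ) ^ 2) {M N : ℕ → ℕ} {u v : ℝ}
    (hv : 0 < v) (hM : Tendsto (fun n : ℕ => (M n : ℝ) / √(n : ℝ)) atTop (𝓝 u))
    (hN : Tendsto (fun n : ℕ => (N n : ℝ) / √(n : ℝ)) atTop (𝓝 v)) :
    (fun n : ℕ => √(n : ℝ) * nStep α hα μ n (M n) (N n))
      ~[atTop] fun _ => limitDensity α (diffConst α μ) u v :=
  (isEquivalent_const_iff_tendsto (limitDensity_pos (by linarith)
    (diffConst_pos hα (exists_mem_support_ne_zero hμ) hmom) hv u).ne').2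
    (tendsto_sqrt_mul_nStep hα hμ hmom hv hM hN)

end GegenbauerWalk

theorem theorem4p4 (α : ℝ) (hα : -1 / 2 ≤ α) (μ : PMF ℕ)
    (hμ : GegenbauerWalk.IsAperiodic α μ)
    (hmom : Summable fun n : ℕ => (μ n).toReal * (n : ℝ) ^ 2)
    (x : ℝ) (hx : 0 < x) :
    ((fun n : ℕ => √(n : ℝ) *
        GegenbauerWalk.nStep α hα μ n ⌊x * √(n : ℝ)⌋₊ ⌊x * √(n : ℝ)⌋₊)
      ~[atTop] fun _ : ℕ =>
        x / (2 * GegenbauerWalk.diffConst α μ)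
          * Real.exp (-(x ^ 2 / (2 * GegenbauerWalk.diffConst α μ)))
          * GegenbauerWalk.besselI α (x ^ 2 / (2 * GegenbauerWalk.diffConst α μ))) ∧
    ((fun n : ℕ => √(n : ℝ) * GegenbauerWalk.nStep α hα μ n 0 ⌊x * √(n : ℝ)⌋₊)
      ~[atTop] fun _ : ℕ =>
        x ^ (2 * α + 1) * Real.exp (-(x ^ 2 / (4 * GegenbauerWalk.diffConst α μ)))
          / ((2 : ℝ) ^ (2 * α + 1) * GegenbauerWalk.diffConst α μ ^ (α + 1)
            * Real.Gamma (α + 1))) := by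
  have hC := GegenbauerWalk.diffConst_pos hα (GegenbauerWalk.exists_mem_support_ne_zero hμ) hmom
  have endpoint_scale := GegenbauerWalk.tendsto_floor_mul_sqrt_div hx.le
  have origin_scale : Tendsto (fun n : ℕ => ((0 : ℕ) : ℝ) / √(n : ℝ)) atTop (nhds 0) := by
    simp only [Nat.cast_zero, zero_div, tendsto_const_nhds]
  rw [← GegenbauerWalk.limitDensity_self (by linarith) hC hx,
    ← GegenbauerWalk.limitDensity_zero_left]
  exact ⟨GegenbauerWalk.isEquivalent_sqrt_mul_nStep hα hμ hmom hx endpoint_scale endpoint_scale,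
    GegenbauerWalk.isEquivalent_sqrt_mul_nStep hα hμ hmom hx origin_scale endpoint_scale⟩
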